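/- Let $n,m\ge 1$. Consider a network of $n$ sensors, given by an undirected graph $\mathscr G$ on $\{1,\dots,n\}$ and a symmetric stochastic weight matrix $\mathcal A=(a_{ij})$. Let $N^i$ be the set consisting of $i$ and of all sensors adjacent to $i$; the weights satisfy $a_{ij}>0$ if $j\in N^i$ (in particular $a_{ii}>0$) and $a_{ij}=0$ otherwise. On a probability space let $\varphi^i_k$ ($k\ge 0$) be random vectors in $\mathbb R^m$ and $\varepsilon^i_k$ ($k\ge1$) real random variables, $1\le i\le n$, let $\theta\in\mathbb R^m$, and suppose that sensor $i$ observes $$y^i_{k+1}=\theta^T\varphi^i_k+\varepsilon^i_{k+1},\qquad k\ge0 .$$ Put $r^i_k=1+\sum_{j=1}^k\|\varphi^i_j\|^2$ and $R_k=\mathrm{diag}(r^1_k,\dots,r^n_k)$, and let $\|R_k\|$ be the spectral norm. Let $Q\ge D(\mathscr G)$ be an integer, where $D(\mathscr G)$ is the diameter of $\mathscr G$ (the largest graph distance between two sensors), and let $\mu,\nu\in(0,1)$. The distributed stochastic gradient (SG) algorithm starts from arbitrary initial estimates $\hat\theta^i_0$ and computes, for $k\ge0$, $$x^i_k(0)=\frac{\|\varphi^i_k\|^2}{r^i_k},\qquad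 x^i_k(q+1)=\sum_{j\in N^i}a_{ij}x^j_k(q)\quad(q\ge 0),\qquad z^i_k=x^i_k(Q)\sum_{l\in N^i}a_{li}\bigl(\hat\theta^i_k-\hat\theta^l_k\bigr),$$ $$\hat\theta^i_{k+1}=\hat\theta^i_k+\mu\frac{\varphi^i_k}{r^i_k}\bigl(y^i_{k+1}-(\varphi^i_k)^T\hat\theta^i_k\bigr)-\mu\nu\sum_{j\in N^i}a_{ij}\bigl(z^i_k-z^j_k\bigr).$$ Assume the following. 1. $\mu(1+4\nu)<1$, and $\mathscr G$ is connected. 2. There is a sensor $i_1$ with $\limsup_{k\to\infty} r^{i_1}_k/r^{i_1}_{k-1}<\infty$ almost surely. 3. The condition number of $R_k$ is bounded: almost surely there is $\gamma>0$, which may depend on the sample $\omega$, such that $\max_i r^i_k/\min_i r^i_k\le\gamma$ for all $k$. 4. (Cooperative excitation) Almost surely $\|R_k\|\to\infty$ as $k\to\infty$, and there are $N>0$ and a positive integer $K_0$ (which may depend on $\omega$) such that $$\frac{\lambda^{(k)}_{\max}}{\lambda^{(k)}_{\min}}\le N\bigl(\log\|R_k\|\bigr)^{1/3}\qquad\text{for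 all }k\ge K_0,$$ where $\lambda^{(k)}_{\max}$ and $\lambda^{(k)}_{\min}$ are the largest and the smallest eigenvalue of $\frac nm I_m+\sum_{i=1}^n\sum_{j=1}^k\varphi^i_j(\varphi^i_j)^T$. 5. (Martingale difference noise) Let $\mathscr F_k=\sigma\{\varphi^i_j\ (0\le j\le k),\ \varepsilon^i_j\ (1\le j\le k),\ 1\le i\le n\}$ and $\Xi_k=(\varepsilon^1_k,\dots,\varepsilon^n_k)$. Every $\varepsilon^i_{k+1}$ is integrable, $E(\Xi_{k+1}\mid\mathscr F_k)=0$ almost surely for all $k\ge0$, and almost surely there are $c_0>0$ and $\varepsilon\in[0,1)$ (which may depend on $\omega$) such that $E(\|\Xi_{k+1}\|^2\mid\mathscr F_k)\le c_0\|R_k\|^{\varepsilon}$ for all $k\ge0$. Then, almost surely, $\hat\theta^i_k\to\theta$ as $k\to\infty$ for every sensor $i\in\{1,\dots,n\}$. No independence or stationarity of the regressors $\varphi^i_k$ is assumed. -/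

import Mathlib

open MeasureTheory Filter
open scoped Topology ENNReal

/-- A network of `n` sensors: an undirected weighted graph in which every sensor counts as one of
its own neighbours, with a symmetric stochastic weight matrix `a` such that `a i j > 0` exactly for
neighbours. Only the edges between distinct sensors are recorded in `graph`. -/
structure SensorNetwork (n : ℕ) where
  graph : SimpleGraph (Fin n)
  a : Matrix (Fin n) (Fin n) ℝ
  symm : a.IsSymm
  pos : ∀ i j, (i = j ∨ graph.Adj i j) → 0 < a i j
  zero : ∀ i j, ¬ (i = j ∨ graph.Adj i j) → a i j = 0
  row_sum : ∀ i, ∑ j, a i j = 1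

namespace SensorNetwork

variable {n : ℕ}

open Classical in
/-- The neighbour set `N^i` of sensor `i`; it contains `i`. -/
noncomputable def nbr (S : SensorNetwork n) (i : Fin n) : Finset (Fin n) :=
  Finset.univ.filter fun j => i = j ∨ S.graph.Adj i j

/-- The diffusion process: `q` rounds of weighted averaging over neighbours, started from `x`. -/
noncomputable def diffuse (S : SensorNetwork n) (x : Fin n → ℝ) : ℕ → Fin n → ℝ
  | 0 => x
  | q + 1 => fun i => ∑ j ∈ S.nbr i, S.a i j * S.diffuse x q j

end SensorNetwork

namespace DistributedSG

section Pathwise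

/-! Deterministic (sample path) quantities: `φ k i` is the regressor of sensor `i` at time `k`. -/

variable {n m : ℕ}

/-- `r^i_k = 1 + ∑_{j=1}^k ‖φ^i_j‖²`. -/
noncomputable def r (φ : ℕ → Fin n → EuclideanSpace ℝ (Fin m)) (k : ℕ) (i : Fin n) : ℝ :=
  1 + ∑ j ∈ Finset.Icc 1 k, ‖φ j i‖ ^ 2

/-- The diagonal matrix `R_k = diag(r^1_k, …, r^n_k)`. -/
noncomputable def R (φ : ℕ → Fin n → EuclideanSpace ℝ (Fin m)) (k : ℕ) :
    Matrix (Fin n) (Fin n) ℝ :=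
  Matrix.diagonal (r φ k)

open scoped Matrix.Norms.L2Operator in
/-- The spectral norm `‖R_k‖`. -/
noncomputable def normR (φ : ℕ → Fin n → EuclideanSpace ℝ (Fin m)) (k : ℕ) : ℝ :=
  ‖R φ k‖

/-- `x^i_k(q)`: the normalized regressor energies after `q` diffusion rounds. -/
noncomputable def x (S : SensorNetwork n) (φ : ℕ → Fin n → EuclideanSpace ℝ (Fin m))
    (k q : ℕ) : Fin n → ℝ :=
  S.diffuse (fun i => ‖φ k i‖ ^ 2 / r φ k i) q

/-- `z^i_k`, evaluated at the current estimates `t` of all sensors. -/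
noncomputable def z (S : SensorNetwork n) (Q : ℕ) (φ : ℕ → Fin n → EuclideanSpace ℝ (Fin m))
    (k : ℕ) (t : Fin n → EuclideanSpace ℝ (Fin m)) (i : Fin n) : EuclideanSpace ℝ (Fin m) :=
  x S φ k Q i • ∑ l ∈ S.nbr i, S.a l i • (t i - t l)

/-- The estimates of the distributed stochastic gradient algorithm with step sizes `μ`, `ν`,
`Q` diffusion rounds, regressors `φ`, observations `y` and initial estimates `t₀`. -/
noncomputable def estimate (S : SensorNetwork n) (Q : ℕ) (μ ν : ℝ)
    (φ : ℕ → Fin n → EuclideanSpace ℝ (Fin m)) (y : ℕ → Fin n → ℝ)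
    (t₀ : Fin n → EuclideanSpace ℝ (Fin m)) : ℕ → Fin n → EuclideanSpace ℝ (Fin m)
  | 0 => t₀
  | k + 1 => fun i =>
      let t := estimate S Q μ ν φ y t₀ k
      t i + (μ * (y (k + 1) i - inner ℝ (φ k i) (t i)) / r φ k i) • φ k i
        - (μ * ν) • ∑ j ∈ S.nbr i, S.a i j • (z S Q φ k t i - z S Q φ k t j)

/-- The matrix `(n/m) I_m + ∑_{i=1}^n ∑_{j=1}^k φ^i_j (φ^i_j)ᵀ`. -/
noncomputable def info (φ : ℕ → Fin n → EuclideanSpace ℝ (Fin m)) (k : ℕ) :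
    Matrix (Fin m) (Fin m) ℝ :=
  ((n : ℝ) / (m : ℝ)) • (1 : Matrix (Fin m) (Fin m) ℝ) +
    ∑ i, ∑ j ∈ Finset.Icc 1 k, Matrix.vecMulVec (fun p => φ j i p) (fun p => φ j i p)

/-- Largest eigenvalue of a real (symmetric) matrix. -/
noncomputable def lamMax (A : Matrix (Fin m) (Fin m) ℝ) : ℝ := sSup (spectrum ℝ A)

/-- Smallest eigenvalue of a real (symmetric) matrix. -/
noncomputable def lamMin (A : Matrix (Fin m) (Fin m) ℝ) : ℝ := sInf (spectrum ℝ A)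

end Pathwise

section Random

/-- `F_k`, generated by `φ^i_j` for `0 ≤ j ≤ k` and by `ε^i_j` for `1 ≤ j ≤ k`. -/
abbrev history {Ω : Type*} {n m : ℕ} (φ : ℕ → Fin n → Ω → EuclideanSpace ℝ (Fin m)) (ε : ℕ → Fin n → Ω → ℝ)
    (k : ℕ) : MeasurableSpace Ω :=
  (⨆ (i : Fin n) (j : ℕ) (_ : j ≤ k), MeasurableSpace.comap (φ j i) inferInstance) ⊔
    (⨆ (i : Fin n) (j : ℕ) (_ : 1 ≤ j ∧ j ≤ k), MeasurableSpace.comap (ε j i) inferInstance)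

variable {Ω : Type*} [MeasurableSpace Ω] {n m : ℕ}

/-- Cooperative excitation condition. The constants `N`, `K₀` may depend on the sample. -/
def CooperativeExcitation (P : Measure Ω) (φ : ℕ → Fin n → Ω → EuclideanSpace ℝ (Fin m)) : Prop :=
  ∀ᵐ ω ∂P,
    (∃ N : ℝ, 0 < N ∧ ∃ K₀ : ℕ, 0 < K₀ ∧ ∀ k, K₀ ≤ k →
      lamMax (info (fun k i => φ k i ω) k) / lamMin (info (fun k i => φ k i ω) k)
        ≤ N * Real.log (normR (fun k i => φ k i ω) k) ^ (1 / 3 : ℝ)) ∧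
    Tendsto (fun k => normR (fun k i => φ k i ω) k) atTop atTop

/-- The condition number of `R_k` is bounded in `k`, by a constant that may depend on the sample. -/
def BoundedConditionNumber (P : Measure Ω) (φ : ℕ → Fin n → Ω → EuclideanSpace ℝ (Fin m)) :
    Prop :=
  ∀ᵐ ω ∂P, ∃ γ : ℝ, 0 < γ ∧ ∀ k,
    (⨆ i, r (fun k i => φ k i ω) k i) / (⨅ i, r (fun k i => φ k i ω) k i) ≤ γ

/-- `limsup_k r^i_k / r^i_{k-1} < ∞` almost surely, for sensor `i`. -/
def BoundedGrowth (P : Measure Ω) (φ : ℕ → Fin n → Ω → EuclideanSpace ℝ (Fin m)) (i : Fin n) :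
    Prop :=
  ∀ᵐ ω ∂P, limsup (fun k : ℕ =>
    ((r (fun k i => φ k i ω) (k + 1) i / r (fun k i => φ k i ω) k i : ℝ) : EReal)) atTop < ⊤

/-- The noise is a martingale difference sequence, and its conditional second moment is at most
`c₀ ‖R_k‖^e` with `c₀ > 0` and `e ∈ [0,1)` that may depend on the sample. The conditional
expectation of the nonnegative variable `‖Ξ_{k+1}‖²` is the `[0,∞]`-valued one, so that
unconditional square integrability is not required. -/
structure MartingaleDifferenceNoise (P : Measure Ω)
    (φ : ℕ → Fin n → Ω → EuclideanSpace ℝ (Fin m)) (ε : ℕ → Fin n → Ω → ℝ) : Prop where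
  integrable : ∀ k i, Integrable (ε (k + 1) i) P
  condExp_eq_zero : ∀ k i, P[ε (k + 1) i | history φ ε k] =ᵐ[P] 0
  second_moment : ∀ᵐ ω ∂P, ∃ c₀ : ℝ, 0 < c₀ ∧ ∃ e : ℝ, 0 ≤ e ∧ e < 1 ∧ ∀ k,
    (P⁻[fun ω => ENNReal.ofReal (∑ i, ε (k + 1) i ω ^ 2) | history φ ε k]) ω
      ≤ ENNReal.ofReal (c₀ * normR (fun k i => φ k i ω) k ^ e)

end Random

end DistributedSG

/-! The error e_k = θ - θ̂_k obeys e_{k+1} = (I - μ G_k) e_k - μ w_k, where w_k is the normalized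
noise, G_k = F_k + ν L X_k L, L = I - A is the network Laplacian, F_k comes from the regressors and
X_k from the diffused energies (`error_succ`). For k ≥ 1, G_k is symmetric and 0 ≤ μ G_k ≤ I, so
homogeneous solutions never gain energy.

Write σ_k for `totalR`. Diffusion over at least the diameter gives every sensor a fixed share of the
total normalized energy, so G_k bounds the disagreement between sensors from below, while F_k
excites the network average (`exists_pos_mul_le_inner_gain`). With log σ as clock, summation by
parts turns the condition number bound into excitation over [s, t) of order (log σ_t - log σ_s) /
(log σ_t)^{1/3} (`exists_errorGain_excitation`).

On blocks where x = log σ grows by about x^{1/3}, a homogeneous solution whose energy stays above δ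
loses energy of order x^{-2/3}, which is also the order of the growth of log x. Since log x is
unbounded, the energy would be exhausted; hence homogeneous solutions vanish
(`tendsto_zero_of_excitation`).

For the noise, the local martingale convergence theorem makes ∑ σ_k^δ w_k converge for some δ > 0
(`ae_exists_bounded_noise`), so the tails T_k of ∑ w_k are O(σ^{-δ}). Subtracting the tail from the
error moves the noise inside G_k, as a forcing whose energy ∑ ⟨G_k T_k, T_k⟩ is summable; such a
forcing does not destroy convergence (`tendsto_zero_of_forced`). -/

/-! ### Local convergence of martingale transforms -/

section Martingale

variable {Ω : Type*} {m0 : MeasurableSpace Ω} {P : Measure Ω}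

/-- Pull-out property of the `[0,∞]`-valued conditional expectation, in integrated form. -/
theorem lintegral_mul_condLExp [IsFiniteMeasure P] {m : MeasurableSpace Ω} (hm : m ≤ m0)
    {f X : Ω → ℝ≥0∞} (hf : Measurable[m] f) (hX : Measurable[m0] X) :
    ∫⁻ ω, f ω * (P⁻[X | m]) ω ∂P = ∫⁻ ω, f ω * X ω ∂P := by
  -- An `m`-measurable integrand sees a measure only through its restriction to `m`, where the two
  -- densities agree.
  have key : (P.withDensity (P⁻[X | m])).trim hm = (P.withDensity X).trim hm := by
    refine @Measure.ext _ m _ _ fun s hs => ?_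
    rw [trim_measurableSet_eq hm hs, trim_measurableSet_eq hm hs, withDensity_apply _ (hm s hs),
      withDensity_apply _ (hm s hs), setLIntegral_condLExp hm P X hs]
  have h1 : ∀ Y : Ω → ℝ≥0∞, Measurable[m0] Y →
      ∫⁻ ω, f ω * Y ω ∂P = ∫⁻ ω, f ω ∂((P.withDensity Y).trim hm) := by
    intro Y hY
    rw [lintegral_trim hm hf, lintegral_withDensity_eq_lintegral_mul _ hY (hf.mono hm le_rfl)]
    simp [mul_comm]
  rw [h1 _ (measurable_condLExp' m P X), h1 _ hX, key]

/-- A martingale transform with square-integrable increments and bounded total variance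
converges almost surely. -/
theorem ae_tendsto_sum_of_sum_integral_sq_le [IsProbabilityMeasure P] (ℱ : Filtration ℕ m0)
    {Y : ℕ → Ω → ℝ} (hmeas : ∀ k, StronglyMeasurable[ℱ (k + 1)] (Y k))
    (hY : ∀ k, MemLp (Y k) 2 P) (hzero : ∀ k, P[Y k | ℱ k] =ᵐ[P] 0) {C : ℝ}
    (hC : ∀ n, ∑ k ∈ Finset.range n, ∫ ω, Y k ω ^ 2 ∂P ≤ C) :
    ∀ᵐ ω ∂P, ∃ c, Tendsto (fun n => ∑ k ∈ Finset.range n, Y k ω) atTop (𝓝 c) := by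
  set S : ℕ → Ω → ℝ := fun n ω => ∑ k ∈ Finset.range n, Y k ω with hS
  have hSmem : ∀ n, MemLp (S n) 2 P := fun n => memLp_finsetSum _ fun k _ => hY k
  have hSmeas : ∀ n, StronglyMeasurable[ℱ n] (S n) := by
    intro n
    refine Finset.stronglyMeasurable_fun_sum _ fun k hk => ?_
    exact (hmeas k).mono (ℱ.mono (Finset.mem_range.1 hk))
  have hSint : ∀ n, Integrable (S n) P := fun n => (hSmem n).integrable one_le_two
  have hmart : Martingale S ℱ P := by
    refine martingale_of_condExp_sub_eq_zero_nat hSmeas hSint fun k => ?_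
    have : S (k + 1) - S k = Y k := by
      ext ω; simp [hS, Finset.sum_range_succ]
    rw [this]; exact hzero k
  have hcross : ∀ n, ∫ ω, S n ω * Y n ω ∂P = 0 := by
    intro n
    have hint : Integrable (S n * Y n) P := (hSmem n).integrable_mul (hY n)
    have h1 := condExp_mul_of_stronglyMeasurable_left (hSmeas n) hint
      ((hY n).integrable one_le_two)
    calc ∫ ω, S n ω * Y n ω ∂P = ∫ ω, (P[S n * Y n | ℱ n]) ω ∂P :=
          (integral_condExp (ℱ.le n)).symm
      _ = ∫ _, (0 : ℝ) ∂P := by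
          refine integral_congr_ae ?_
          filter_upwards [h1, hzero n] with ω h1 h2
          rw [h1, Pi.mul_apply, h2]; simp
      _ = 0 := by simp
  have hsq : ∀ n, ∫ ω, S n ω ^ 2 ∂P = ∑ k ∈ Finset.range n, ∫ ω, Y k ω ^ 2 ∂P := by
    intro n
    induction n with
    | zero => simp [hS]
    | succ n ih =>
      have e : ∀ ω, S (n + 1) ω ^ 2 = S n ω ^ 2 + 2 * (S n ω * Y n ω) + Y n ω ^ 2 := by
        intro ω; simp only [hS, Finset.sum_range_succ]; ring
      simp_rw [e]
      have i1 := (hSmem n).integrable_sq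
      have i2 : Integrable (fun ω => 2 * (S n ω * Y n ω)) P :=
        ((hSmem n).integrable_mul (hY n)).const_mul 2
      rw [integral_add (by exact i1.add i2) (hY n).integrable_sq, integral_add i1 i2, integral_const_mul,
        hcross, ih, Finset.sum_range_succ]
      ring
  have hbdd : ∀ n, eLpNorm (S n) 1 P ≤ ((1 + C).toNNReal : ℝ≥0∞) := by
    intro n
    rw [eLpNorm_one_eq_lintegral_enorm, ← ofReal_integral_norm_eq_lintegral_enorm (hSint n)]
    refine ENNReal.ofReal_le_ofReal ?_
    calc ∫ ω, ‖S n ω‖ ∂P ≤ ∫ ω, (1 + S n ω ^ 2) ∂P := by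
          refine integral_mono (hSint n).norm ((integrable_const 1).add (hSmem n).integrable_sq) ?_
          intro ω
          simp only [Real.norm_eq_abs]
          nlinarith [sq_abs (S n ω), sq_nonneg (|S n ω| - 1)]
      _ = 1 + ∫ ω, S n ω ^ 2 ∂P := by
          rw [integral_add (integrable_const 1) (hSmem n).integrable_sq]; simp
      _ ≤ 1 + C := by rw [hsq]; linarith [hC n]
  exact hmart.submartingale.exists_ae_tendsto_of_bdd hbdd

/-- Local convergence theorem for martingale transforms: `∑ c_k ε_k` converges almost surely on
the event that `∑ c_k² E(ε_k² | ℱ_k)` is finite. -/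
theorem ae_tendsto_sum_of_tsum_condLExp_lt_top [IsProbabilityMeasure P] (ℱ : Filtration ℕ m0)
    {c ξ : ℕ → Ω → ℝ} (hc : ∀ k, Measurable[ℱ k] (c k)) (hξ : ∀ k, Measurable[ℱ (k + 1)] (ξ k))
    (hint : ∀ k, Integrable (ξ k) P) (hzero : ∀ k, P[ξ k | ℱ k] =ᵐ[P] 0) :
    ∀ᵐ ω ∂P, ∑' k, ENNReal.ofReal (c k ω ^ 2) *
        (P⁻[fun ω => ENNReal.ofReal (ξ k ω ^ 2) | ℱ k]) ω < ⊤ →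
      ∃ l, Tendsto (fun n => ∑ k ∈ Finset.range n, c k ω * ξ k ω) atTop (𝓝 l) := by
  set V : ℕ → Ω → ℝ≥0∞ := fun k ω => ENNReal.ofReal (c k ω ^ 2) *
        (P⁻[fun ω => ENNReal.ofReal (ξ k ω ^ 2) | ℱ k]) ω with hV
  have hVm : ∀ k, Measurable[ℱ k] (V k) := fun k =>
    Measurable.mul (ENNReal.measurable_ofReal.comp ((hc k).pow_const 2)) (measurable_condLExp _ _ _)
  -- Truncation by the conditional variance up to and including time `k`. Term `k` may be included
  -- because `V k` is already known at time `k`, so the truncated coefficient stays predictable.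
  set B : ℕ → ℕ → Set Ω := fun L k => {ω | ∑ j ∈ Finset.range (k + 1), V j ω ≤ L} with hB
  have hBm : ∀ L k, MeasurableSet[ℱ k] (B L k) := by
    intro L k
    refine @measurableSet_le _ _ _ _ _ (ℱ k) _ _ _ _ _ ?_ measurable_const
    refine Finset.measurable_fun_sum _ fun j hj => ?_
    exact (hVm j).mono (ℱ.mono (by simpa [Nat.lt_succ_iff] using hj)) le_rfl
  have main : ∀ L : ℕ, ∀ᵐ ω ∂P, ∃ l, Tendsto (fun n => ∑ k ∈ Finset.range n,
      (B L k).indicator (c k) ω * ξ k ω) atTop (𝓝 l) := by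
    intro L
    have hcm : ∀ k, Measurable[ℱ k] ((B L k).indicator (c k)) := fun k =>
      (hc k).indicator (hBm L k)
    have hYm : ∀ k, Measurable[ℱ (k + 1)] (fun ω => (B L k).indicator (c k) ω * ξ k ω) := fun k =>
      ((hcm k).mono (ℱ.mono k.le_succ) le_rfl).mul (hξ k)
    have hsum : ∀ n, ∑ k ∈ Finset.range n,
        ∫⁻ ω, ENNReal.ofReal (((B L k).indicator (c k) ω * ξ k ω) ^ 2) ∂P ≤ L := by
      intro n
      have e : ∀ k, ∫⁻ ω, ENNReal.ofReal (((B L k).indicator (c k) ω * ξ k ω) ^ 2) ∂P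
          = ∫⁻ ω, (B L k).indicator (V k) ω ∂P := by
        intro k
        have h1 := lintegral_mul_condLExp (P := P) (ℱ.le k)
          (f := fun ω => ENNReal.ofReal ((B L k).indicator (c k) ω ^ 2))
          (X := fun ω => ENNReal.ofReal (ξ k ω ^ 2))
          (ENNReal.measurable_ofReal.comp ((hcm k).pow_const 2))
          (ENNReal.measurable_ofReal.comp (((hξ k).mono (ℱ.le _) le_rfl).pow_const 2))
        simp_rw [mul_pow, ENNReal.ofReal_mul (sq_nonneg _)]
        rw [← h1]
        refine lintegral_congr fun ω => ?_
        by_cases h : ω ∈ B L k <;> simp [h, hV]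
      simp_rw [e]
      rw [← lintegral_finsetSum _ fun k _ =>
        ((hVm k).mono (ℱ.le k) le_rfl).indicator (ℱ.le k _ (hBm L k))]
      calc _ ≤ ∫⁻ _, (L : ℝ≥0∞) ∂P := by
            refine lintegral_mono fun ω => ?_
            induction n with
            | zero => simp
            | succ n ih =>
              -- Either the untruncated sum through `n` is already at most `L`, or the last
              -- truncated term vanishes.
              by_cases h : ω ∈ B L n
              · refine le_trans ?_ h
                exact Finset.sum_le_sum fun k _ => Set.indicator_le_self _ _ _
              · rw [Finset.sum_range_succ]; simpa [h] using ih
        _ = L := by simp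
    have hL2 : ∀ k, MemLp (fun ω => (B L k).indicator (c k) ω * ξ k ω) 2 P := by
      intro k
      refine (memLp_two_iff_integrable_sq
        ((hYm k).mono (ℱ.le _) le_rfl).aestronglyMeasurable).2 ⟨?_, ?_⟩
      · exact (((hYm k).mono (ℱ.le _) le_rfl).pow_const 2).aestronglyMeasurable
      · rw [hasFiniteIntegral_iff_ofReal (Eventually.of_forall fun ω => sq_nonneg _)]
        refine lt_of_le_of_lt ?_ (ENNReal.natCast_lt_top L)
        exact le_trans (Finset.single_le_sum (f := fun k => ∫⁻ ω, ENNReal.ofReal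
          (((B L k).indicator (c k) ω * ξ k ω) ^ 2) ∂P) (fun _ _ => zero_le)
          (Finset.self_mem_range_succ k)) (hsum (k + 1))
    refine ae_tendsto_sum_of_sum_integral_sq_le ℱ (C := L) (fun k => (hYm k).stronglyMeasurable) hL2
      (fun k => ?_) (fun n => ?_)
    · have h1 := condExp_mul_of_stronglyMeasurable_left (m := ℱ k) (μ := P)
        (hcm k).stronglyMeasurable (g := ξ k) ((hL2 k).integrable one_le_two) (hint k)
      filter_upwards [h1, hzero k] with ω h1 h2
      refine h1.trans ?_
      rw [Pi.mul_apply, h2]; simp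
    · have := ENNReal.toReal_mono (ENNReal.natCast_ne_top L) (hsum n)
      rw [ENNReal.toReal_sum, ENNReal.toReal_natCast] at this
      · refine le_trans (le_of_eq (Finset.sum_congr rfl fun k _ => ?_)) this
        rw [integral_eq_lintegral_of_nonneg_ae (Eventually.of_forall fun ω => sq_nonneg _)
          (((hYm k).mono (ℱ.le _) le_rfl).pow_const 2).aestronglyMeasurable]
      · intro k _
        have := (hL2 k).integrable_sq.2
        rw [hasFiniteIntegral_iff_ofReal (Eventually.of_forall fun ω => sq_nonneg _)] at this
        exact this.ne
  filter_upwards [ae_all_iff.2 main] with ω hω hfin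
  obtain ⟨L, hL⟩ := ENNReal.exists_nat_gt hfin.ne
  obtain ⟨l, hl⟩ := hω L
  refine ⟨l, hl.congr fun n => Finset.sum_congr rfl fun k _ => ?_⟩
  have : ω ∈ B L k := (ENNReal.sum_le_tsum _).trans hL.le
  rw [Set.indicator_of_mem this]

end Martingale

/-! ### Recursions driven by symmetric nonnegative operators -/

section Recursion

variable {H : Type*} [NormedAddCommGroup H] [InnerProductSpace ℝ H]

/-- A symmetric linear map with nonnegative quadratic form. -/
def IsSymmNonneg (G : H →ₗ[ℝ] H) : Prop :=
  (∀ v w, inner ℝ (G v) w = inner ℝ v (G w)) ∧ ∀ v, 0 ≤ inner ℝ (G v) v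

namespace IsSymmNonneg

variable {G : H →ₗ[ℝ] H}

theorem inner_add_self (hG : IsSymmNonneg G) (v w : H) :
    inner ℝ (G (v + w)) (v + w) =
      inner ℝ (G v) v + 2 * inner ℝ (G v) w + inner ℝ (G w) w := by
  rw [map_add, inner_add_left, inner_add_right, inner_add_right, hG.1 w v, real_inner_comm (G v) w]
  ring

theorem inner_sub_self (hG : IsSymmNonneg G) (v w : H) :
    inner ℝ (G (v - w)) (v - w) =
      inner ℝ (G v) v - 2 * inner ℝ (G v) w + inner ℝ (G w) w := by
  rw [map_sub, inner_sub_left, inner_sub_right, inner_sub_right, hG.1 w v, real_inner_comm (G v) w]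
  ring

theorem two_mul_inner_le (hG : IsSymmNonneg G) (v w : H) :
    2 * inner ℝ (G v) w ≤ inner ℝ (G v) v + inner ℝ (G w) w := by
  have := hG.2 (v - w)
  rw [hG.inner_sub_self] at this
  linarith

theorem inner_self_le_two_mul (hG : IsSymmNonneg G) (v w : H) :
    inner ℝ (G v) v ≤ 2 * inner ℝ (G w) w + 2 * inner ℝ (G (v - w)) (v - w) := by
  have h := hG.inner_add_self w (v - w)
  rw [add_sub_cancel] at h
  linarith [hG.two_mul_inner_le w (v - w)]

/-- The operator inequality G² ≤ gG, read off from nonnegativity of the form at v - t G v with t =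
1/g. For g = 0 the choice t = 1 suffices. -/
theorem norm_map_sq_le (hG : IsSymmNonneg G) {g : ℝ} (hg : 0 ≤ g)
    (hb : ∀ v, inner ℝ (G v) v ≤ g * ‖v‖ ^ 2) (v : H) :
    ‖G v‖ ^ 2 ≤ g * inner ℝ (G v) v := by
  have key : ∀ t : ℝ, 0 ≤ inner ℝ (G v) v - 2 * t * ‖G v‖ ^ 2 + t ^ 2 * (g * ‖G v‖ ^ 2) := by
    intro t
    have h1 := hG.2 (v - t • G v)
    rw [hG.inner_sub_self, map_smul, inner_smul_right, inner_smul_right, inner_smul_left,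
      real_inner_self_eq_norm_sq] at h1
    have h2 := mul_le_mul_of_nonneg_left (hb (G v)) (sq_nonneg t)
    simp only [conj_trivial] at h1
    nlinarith
  rcases hg.eq_or_lt with rfl | hg
  · have h0 : inner ℝ (G v) v ≤ 0 := by simpa using hb v
    have := key 1
    nlinarith
  · have := key g⁻¹
    have e : g⁻¹ ^ 2 * (g * ‖G v‖ ^ 2) = g⁻¹ * ‖G v‖ ^ 2 := by field_simp
    rw [e] at this
    have h3 : g⁻¹ * ‖G v‖ ^ 2 ≤ inner ℝ (G v) v := by linarith
    rwa [inv_mul_le_iff₀ hg] at h3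

/-- One step of the forced recursion. -/
theorem norm_step_sq_le (hG : IsSymmNonneg G) {μ : ℝ} (hμ : 0 < μ)
    (hb : ∀ v, μ * inner ℝ (G v) v ≤ ‖v‖ ^ 2) (u T : H) :
    ‖u - μ • G (u + T)‖ ^ 2 ≤
      ‖u‖ ^ 2 - μ * inner ℝ (G (u + T)) (u + T) + 2 * μ * inner ℝ (G (u + T)) T := by
  have h1 : ‖G (u + T)‖ ^ 2 ≤ μ⁻¹ * inner ℝ (G (u + T)) (u + T) := by
    refine hG.norm_map_sq_le (inv_nonneg.2 hμ.le) (fun v => ?_) _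
    rw [le_inv_mul_iff₀ hμ]; exact hb v
  rw [le_inv_mul_iff₀ hμ] at h1
  rw [norm_sub_sq_real, norm_smul, inner_smul_right, mul_pow, Real.norm_eq_abs, sq_abs,
    real_inner_comm]
  have h2 : inner ℝ (G (u + T)) u = inner ℝ (G (u + T)) (u + T) - inner ℝ (G (u + T)) T := by
    rw [inner_add_right]; ring
  rw [h2]
  nlinarith [mul_le_mul_of_nonneg_left h1 hμ.le]

/-- The cross term 2⟨G(u+T), T⟩ is absorbed by the dissipation ⟨G(u+T), u+T⟩, so a forcing placed
inside `G` costs only its own `G`-energy. -/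
theorem norm_step_sq_le_add (hG : IsSymmNonneg G) {μ : ℝ} (hμ : 0 < μ)
    (hb : ∀ v, μ * inner ℝ (G v) v ≤ ‖v‖ ^ 2) (u T : H) :
    ‖u - μ • G (u + T)‖ ^ 2 ≤ ‖u‖ ^ 2 + μ * inner ℝ (G T) T := by
  have h1 := hG.norm_step_sq_le hμ hb u T
  have h2 := mul_le_mul_of_nonneg_left (hG.two_mul_inner_le (u + T) T) hμ.le
  nlinarith

theorem norm_step_sq_le_sub (hG : IsSymmNonneg G) {μ : ℝ} (hμ : 0 < μ)
    (hb : ∀ v, μ * inner ℝ (G v) v ≤ ‖v‖ ^ 2) (v : H) :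
    ‖v - μ • G v‖ ^ 2 ≤ ‖v‖ ^ 2 - μ * inner ℝ (G v) v := by
  simpa using hG.norm_step_sq_le hμ hb v 0

end IsSymmNonneg

variable {G : ℕ → H →ₗ[ℝ] H} {μ : ℝ}

/-- On a block of times, the excitation in the direction of the initial state is controlled by the
loss of energy over the block. -/
theorem sum_inner_le_of_recursion (hG : ∀ k, IsSymmNonneg (G k)) (hμ : 0 < μ)
    (hb : ∀ k v, μ * inner ℝ (G k v) v ≤ ‖v‖ ^ 2) {g : ℕ → ℝ} (hg0 : ∀ k, 0 ≤ g k)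
    (hg : ∀ k v, inner ℝ (G k v) v ≤ g k * ‖v‖ ^ 2) {v : ℕ → H} {s t : ℕ} (hst : s ≤ t)
    (hv : ∀ k, s ≤ k → v (k + 1) = v k - μ • G k (v k)) :
    μ * ∑ k ∈ Finset.Ico s t, inner ℝ (G k (v s)) (v s) ≤
      (2 + 2 * μ ^ 2 * (∑ k ∈ Finset.Ico s t, g k) ^ 2) * (‖v s‖ ^ 2 - ‖v t‖ ^ 2) := by
  set q : ℕ → ℝ := fun k => inner ℝ (G k (v k)) (v k) with hq
  have hq0 : ∀ k, 0 ≤ q k := fun k => (hG k).2 _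
  have henergy : ∀ t, s ≤ t → μ * ∑ k ∈ Finset.Ico s t, q k ≤ ‖v s‖ ^ 2 - ‖v t‖ ^ 2 := by
    intro t hst
    induction t, hst using Nat.le_induction with
    | base => simp
    | succ t hst ih =>
      rw [Finset.sum_Ico_succ_top hst, hv t hst]
      have := (hG t).norm_step_sq_le_sub hμ (hb t) (v t)
      linarith
  set B := ∑ k ∈ Finset.Ico s t, g k with hB
  set M := ∑ k ∈ Finset.Ico s t, q k with hM
  have hB0 : 0 ≤ B := Finset.sum_nonneg fun k _ => hg0 k
  have hM0 : 0 ≤ M := Finset.sum_nonneg fun k _ => hq0 k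
  -- Each increment is controlled by ‖G v‖² ≤ g q. Cauchy–Schwarz then bounds the drift by the
  -- dissipated energy, which allows the moving state to be replaced by `v s`.
  have hdist : ∀ k, s ≤ k → ‖v s - v k‖ ≤ μ * ∑ j ∈ Finset.Ico s k, √(g j) * √(q j) := by
    intro k hk
    induction k, hk using Nat.le_induction with
    | base => simp
    | succ k hk ih =>
      rw [Finset.sum_Ico_succ_top hk, mul_add, hv k hk]
      have e : v s - (v k - μ • G k (v k)) = (v s - v k) + μ • G k (v k) := by abel
      rw [e]
      refine (norm_add_le _ _).trans (add_le_add ih ?_)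
      rw [norm_smul, Real.norm_of_nonneg hμ.le]
      refine mul_le_mul_of_nonneg_left ?_ hμ.le
      rw [← Real.sqrt_mul (hg0 k)]
      exact Real.le_sqrt_of_sq_le ((hG k).norm_map_sq_le (hg0 k) (hg k) _)
  have hdist2 : ∀ k ∈ Finset.Ico s t, ‖v s - v k‖ ^ 2 ≤ μ ^ 2 * (B * M) := by
    intro k hk
    have hk' := Finset.mem_Ico.1 hk
    have h1 : ‖v s - v k‖ ≤ μ * (√B * √M) := by
      refine (hdist k hk'.1).trans (mul_le_mul_of_nonneg_left ?_ hμ.le)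
      refine le_trans (Finset.sum_le_sum_of_subset_of_nonneg
        (Finset.Ico_subset_Ico le_rfl hk'.2.le) fun _ _ _ => by positivity) ?_
      exact Real.sum_sqrt_mul_sqrt_le _ (fun k => hg0 k) (fun k => hq0 k)
    calc ‖v s - v k‖ ^ 2 ≤ (μ * (√B * √M)) ^ 2 := by gcongr
      _ = μ ^ 2 * (B * M) := by
        rw [mul_pow, mul_pow, Real.sq_sqrt hB0, Real.sq_sqrt hM0]
  have h2 : ∑ k ∈ Finset.Ico s t, inner ℝ (G k (v s)) (v s) ≤ 2 * M + 2 * (B * (μ ^ 2 * (B * M))) := by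
    rw [hM, hB, Finset.mul_sum, Finset.sum_mul, Finset.mul_sum, ← Finset.sum_add_distrib]
    refine Finset.sum_le_sum fun k hk => ?_
    refine ((hG k).inner_self_le_two_mul (v s) (v k)).trans ?_
    have := (hg k (v s - v k)).trans (mul_le_mul_of_nonneg_left (hdist2 k hk) (hg0 k))
    linarith
  calc μ * ∑ k ∈ Finset.Ico s t, inner ℝ (G k (v s)) (v s)
      ≤ μ * (2 * M + 2 * (B * (μ ^ 2 * (B * M)))) := by gcongr
    _ = (2 + 2 * μ ^ 2 * B ^ 2) * (μ * M) := by ring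
    _ ≤ _ := mul_le_mul_of_nonneg_left (henergy t hst) (by positivity)

/-- A block on which `x` grows by at least `a` and at most `a + ρ`. -/
theorem exists_block {x : ℕ → ℝ} (hxt : Tendsto x atTop atTop) {ρ : ℝ}
    {s : ℕ} (hstep : ∀ k, s ≤ k → x (k + 1) ≤ x k + ρ) {a : ℝ} (ha : 0 < a) :
    ∃ t, s < t ∧ x s + a ≤ x t ∧ x t ≤ x s + a + ρ := by
  have hex : ∃ j, x s + a ≤ x (s + j) := by
    obtain ⟨t, ht⟩ := (hxt.eventually_ge_atTop (x s + a)).exists_forall_of_atTop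
    exact ⟨t, ht _ (Nat.le_add_left _ _)⟩
  classical
  have h1 := Nat.find_spec hex
  rcases hj : Nat.find hex with _ | j
  · rw [hj] at h1; simp at h1; linarith
  · rw [hj] at h1
    have h2 := Nat.find_min hex (m := j) (by omega)
    refine ⟨s + (j + 1), by omega, h1, ?_⟩
    have := hstep (s + j) (by omega)
    rw [← add_assoc]; linarith

theorem norm_sq_le_of_recursion (hG : ∀ k, IsSymmNonneg (G k)) (hμ : 0 < μ)
    (hb : ∀ k v, μ * inner ℝ (G k v) v ≤ ‖v‖ ^ 2) {v : ℕ → H} {k l : ℕ}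
    (hv : ∀ j, k ≤ j → v (j + 1) = v j - μ • G j (v j)) (hl : k ≤ l) :
    ‖v l‖ ^ 2 ≤ ‖v k‖ ^ 2 := by
  induction l, hl using Nat.le_induction with
  | base => exact le_rfl
  | succ l hl ih =>
    rw [hv l hl]
    have := (hG l).norm_step_sq_le_sub hμ (hb l) (v l)
    have := mul_nonneg hμ.le ((hG l).2 (v l))
    linarith

/-- Over a suitable block starting at a late time `s`, a homogeneous solution of energy at least `δ`
loses energy proportional to the growth of `log x`. -/
theorem exists_block_energy_loss (hG : ∀ k, IsSymmNonneg (G k)) (hμ : 0 < μ)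
    (hb : ∀ k v, μ * inner ℝ (G k v) v ≤ ‖v‖ ^ 2) {x : ℕ → ℝ} (hx : Monotone x)
    (hxt : Tendsto x atTop atTop) {C : ℝ} (hC : 0 ≤ C)
    (hg : ∀ k v, inner ℝ (G k v) v ≤ C * (x (k + 1) - x k) * ‖v‖ ^ 2)
    {ρ : ℝ} (hρ : 0 ≤ ρ) {c D : ℝ} (hc : 0 < c) (hD : 0 < D) {δ : ℝ} (hδ : 0 < δ)
    {v : ℕ → H} {s : ℕ} (hs1 : ∀ k, s ≤ k → x (k + 1) ≤ x k + ρ)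
    (hs2 : ∀ t, s ≤ t → ∀ v, c * ((x t - x s) / (D * x t ^ (1 / 3 : ℝ)) - 1) * ‖v‖ ^ 2
      ≤ ∑ k ∈ Finset.Ico s t, inner ℝ (G k v) v)
    (hs4 : (1 + 4 * D + ρ) ^ 3 ≤ x s) (hlow : δ ≤ ‖v s‖ ^ 2)
    (hv : ∀ k, s ≤ k → v (k + 1) = v k - μ • G k (v k)) :
    ∃ t, s < t ∧ μ * c * δ / ((2 + 2 * μ ^ 2 * (C * (4 * D + ρ)) ^ 2) * (4 * D + ρ)) *
      (Real.log (x t) - Real.log (x s)) ≤ ‖v s‖ ^ 2 - ‖v t‖ ^ 2 := by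
  -- The block has length about K y with y = (x s)^{1/3}. The threshold on `x s` keeps (x t)^{1/3} ≤
  -- 2y, so K = 4D makes (x t - x s) / (D (x t)^{1/3}) at least 2, and the bracket in `hs2` at least
  -- 1.
  set K := 4 * D with hK
  have hK0 : 0 < K := by positivity
  set A := 2 + 2 * μ ^ 2 * (C * (K + ρ)) ^ 2 with hA
  have hA0 : 0 < A := by positivity
  set y := x s ^ (1 / 3 : ℝ) with hy
  have hxs : 0 < x s := lt_of_lt_of_le (by positivity) hs4
  have hy3 : y ^ 3 = x s := by
    rw [hy, ← Real.rpow_natCast, ← Real.rpow_mul hxs.le]; norm_num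
  have hy0 : 0 < y := Real.rpow_pos_of_pos hxs _
  have hyY : 1 + K + ρ ≤ y := by
    rw [← hy3] at hs4
    exact le_of_pow_le_pow_left₀ three_ne_zero hy0.le hs4
  have hy1 : 1 ≤ y := by linarith
  obtain ⟨t, hst, ht1, ht2⟩ := exists_block hxt hs1 (mul_pos hK0 hy0)
  have hdx : x t - x s ≤ (K + ρ) * y := by nlinarith
  have hxt8 : x t ≤ (2 * y) ^ 3 := by
    have : (K + ρ) * y ≤ y ^ 3 := by
      calc (K + ρ) * y ≤ y * y := by gcongr; linarith
        _ ≤ y * y * y := le_mul_of_one_le_right (by positivity) hy1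
        _ = y ^ 3 := by ring
    nlinarith [pow_pos hy0 3]
  have hxtpos : 0 < x t := hxs.trans_le (hx hst.le)
  have hxt13 : x t ^ (1 / 3 : ℝ) ≤ 2 * y := by
    calc x t ^ (1 / 3 : ℝ) ≤ ((2 * y) ^ 3) ^ (1 / 3 : ℝ) := by gcongr
      _ = 2 * y := by
        rw [← Real.rpow_natCast, ← Real.rpow_mul (by positivity)]; norm_num
  have hge : 1 ≤ (x t - x s) / (D * x t ^ (1 / 3 : ℝ)) - 1 := by
    have hpos : 0 < x t ^ (1 / 3 : ℝ) := Real.rpow_pos_of_pos hxtpos _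
    rw [le_sub_iff_add_le, le_div_iff₀ (by positivity)]
    have := mul_le_mul_of_nonneg_left hxt13 hD.le
    linarith
  have hsum : ∑ k ∈ Finset.Ico s t, C * (x (k + 1) - x k) = C * (x t - x s) := by
    rw [← Finset.mul_sum, Finset.sum_Ico_sub _ hst.le]
  have h1 := sum_inner_le_of_recursion hG hμ hb
    (g := fun k => C * (x (k + 1) - x k))
    (fun k => mul_nonneg hC (sub_nonneg.2 (hx k.le_succ))) hg hst.le
    hv
  rw [hsum] at h1
  have hV : 0 ≤ ‖v s‖ ^ 2 - ‖v t‖ ^ 2 := sub_nonneg.2 (norm_sq_le_of_recursion hG hμ hb hv hst.le)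
  have h2 : c * δ ≤ ∑ k ∈ Finset.Ico s t, inner ℝ (G k (v s)) (v s) := by
    refine le_trans ?_ (hs2 t hst.le (v s))
    have : c * 1 ≤ c * ((x t - x s) / (D * x t ^ (1 / 3 : ℝ)) - 1) := by gcongr
    calc c * δ = c * 1 * δ := by ring
      _ ≤ _ := mul_le_mul this hlow hδ.le (by linarith)
  have hdx0 : 0 ≤ x t - x s := sub_nonneg.2 (hx hst.le)
  have h3 : 2 + 2 * μ ^ 2 * (C * (x t - x s)) ^ 2 ≤ A * y ^ 2 := by
    have e1 : (C * (x t - x s)) ^ 2 ≤ (C * ((K + ρ) * y)) ^ 2 := by gcongr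
    have e2 := mul_le_mul_of_nonneg_left e1 (by positivity : 0 ≤ 2 * μ ^ 2)
    have e3 : (1 : ℝ) ≤ y ^ 2 := one_le_pow₀ hy1
    rw [hA]; nlinarith
  have h4 : μ * (c * δ) ≤ A * y ^ 2 * (‖v s‖ ^ 2 - ‖v t‖ ^ 2) :=
    (mul_le_mul_of_nonneg_left h2 hμ.le).trans (h1.trans (by gcongr))
  refine ⟨t, hst, ?_⟩
  -- The energy loss is at least of order y⁻², because the squared total gain on the block is of
  -- order y². The growth of log x is of order y/x = y⁻² exactly because y = x^{1/3}.
  have hlog : Real.log (x t) - Real.log (x s) ≤ (K + ρ) / y ^ 2 := by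
    rw [← Real.log_div hxtpos.ne' hxs.ne']
    refine (Real.log_le_sub_one_of_pos (div_pos hxtpos hxs)).trans ?_
    rw [le_div_iff₀ (by positivity), div_sub_one hxs.ne', div_mul_eq_mul_div,
      div_le_iff₀ hxs, ← hy3]
    rw [← hy3] at hdx
    linarith [mul_le_mul_of_nonneg_right hdx (by positivity : 0 ≤ y ^ 2)]
  calc μ * c * δ / (A * (K + ρ)) * (Real.log (x t) - Real.log (x s))
      ≤ μ * c * δ / (A * (K + ρ)) * ((K + ρ) / y ^ 2) := by gcongr
    _ = μ * (c * δ) / (A * y ^ 2) := by field_simp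
    _ ≤ ‖v s‖ ^ 2 - ‖v t‖ ^ 2 := by
      rw [div_le_iff₀ (by positivity)]; linarith

/-- Convergence of the homogeneous recursion under excitation of order `x^{-1/3}`. -/
theorem tendsto_zero_of_excitation (hG : ∀ k, IsSymmNonneg (G k)) (hμ : 0 < μ)
    (hb : ∀ k v, μ * inner ℝ (G k v) v ≤ ‖v‖ ^ 2) {x : ℕ → ℝ} (hx : Monotone x)
    (hxt : Tendsto x atTop atTop) {C : ℝ} (hC : 0 ≤ C)
    (hg : ∀ k v, inner ℝ (G k v) v ≤ C * (x (k + 1) - x k) * ‖v‖ ^ 2)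
    {ρ : ℝ} (hρ : 0 ≤ ρ) (hstep : ∀ᶠ k in atTop, x (k + 1) ≤ x k + ρ)
    {c D : ℝ} (hc : 0 < c) (hD : 0 < D)
    (hexc : ∀ᶠ s in atTop, ∀ t, s ≤ t → ∀ v,
      c * ((x t - x s) / (D * x t ^ (1 / 3 : ℝ)) - 1) * ‖v‖ ^ 2
        ≤ ∑ k ∈ Finset.Ico s t, inner ℝ (G k v) v)
    {v : ℕ → H} {k₀ : ℕ} (hv : ∀ k, k₀ ≤ k → v (k + 1) = v k - μ • G k (v k)) :
    Tendsto v atTop (𝓝 0) := by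
  have hanti : ∀ k l, k₀ ≤ k → k ≤ l → ‖v l‖ ^ 2 ≤ ‖v k‖ ^ 2 := fun k l hk hl =>
    norm_sq_le_of_recursion hG hμ hb (fun j hj => hv j (hk.trans hj)) hl
  suffices h : ∀ δ > 0, ∃ k, k₀ ≤ k ∧ ‖v k‖ ^ 2 < δ by
    rw [Metric.tendsto_atTop]
    intro e he
    obtain ⟨k, hk, hlt⟩ := h (e ^ 2) (by positivity)
    refine ⟨k, fun l hl => ?_⟩
    rw [dist_zero_right]
    exact lt_of_pow_lt_pow_left₀ 2 he.le ((hanti k l hk hl).trans_lt hlt)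
  intro δ hδ
  by_contra! hlow
  set κ := μ * c * δ / ((2 + 2 * μ ^ 2 * (C * (4 * D + ρ)) ^ 2) * (4 * D + ρ)) with hκ
  have hκ0 : 0 < κ := by positivity
  have hblock : ∀ᶠ s in atTop, ∃ t, s < t ∧
      κ * (Real.log (x t) - Real.log (x s)) ≤ ‖v s‖ ^ 2 - ‖v t‖ ^ 2 := by
    filter_upwards [eventually_forall_ge_atTop.2 hstep, hexc, eventually_ge_atTop k₀,
      hxt.eventually_ge_atTop ((1 + 4 * D + ρ) ^ 3)] with s hs1 hs2 hs3 hs4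
    exact exists_block_energy_loss hG hμ hb hx hxt hC hg hρ hc hD hδ hs1 hs2 hs4 (hlow s hs3)
      fun k hk => hv k (hs3.trans hk)
  obtain ⟨s₀, hs₀⟩ := hblock.exists_forall_of_atTop
  choose! nxt hnxt1 hnxt2 using hs₀
  -- Chained blocks: the losses telescope, so κ log x along `σ` stays below its initial value plus
  -- the initial energy, although log x is unbounded.
  set σ : ℕ → ℕ := fun k => nxt^[k] s₀ with hσ
  have hσs : ∀ k, σ (k + 1) = nxt (σ k) := fun k => Function.iterate_succ_apply' _ _ _
  have hσge : ∀ k, s₀ + k ≤ σ k := by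
    intro k
    induction k with
    | zero => simp [hσ]
    | succ k ih => rw [hσs]; have := hnxt1 (σ k) (by omega); omega
  have hdec : ∀ k, κ * Real.log (x (σ k)) ≤ κ * Real.log (x s₀) + ‖v s₀‖ ^ 2 - ‖v (σ k)‖ ^ 2 := by
    intro k
    induction k with
    | zero => simp [hσ]
    | succ k ih =>
      rw [hσs]
      have := hnxt2 (σ k) (by have := hσge k; omega)
      linarith
  have hσt : Tendsto σ atTop atTop :=
    tendsto_atTop_mono (fun k => (Nat.le_add_left _ _).trans (hσge k)) tendsto_id
  have hlim : Tendsto (fun k => κ * Real.log (x (σ k))) atTop atTop :=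
    (Real.tendsto_log_atTop.comp (hxt.comp hσt)).const_mul_atTop hκ0
  obtain ⟨k, hk⟩ := (hlim.eventually_gt_atTop (κ * Real.log (x s₀) + ‖v s₀‖ ^ 2)).exists
  have := hdec k
  nlinarith [sq_nonneg ‖v (σ k)‖]

/-- If all homogeneous solutions tend to zero, so do the forced ones when the forcing has
summable energy. -/
theorem tendsto_zero_of_forced (hG : ∀ k, IsSymmNonneg (G k)) (hμ : 0 < μ)
    (hb : ∀ k v, μ * inner ℝ (G k v) v ≤ ‖v‖ ^ 2)
    (hhom : ∀ (v : ℕ → H) (k₀ : ℕ), (∀ k, k₀ ≤ k → v (k + 1) = v k - μ • G k (v k)) →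
      Tendsto v atTop (𝓝 0))
    {u T : ℕ → H} (hu : ∀ k, u (k + 1) = u k - μ • G k (u k + T k))
    (hT : Summable fun k => inner ℝ (G k (T k)) (T k)) :
    Tendsto u atTop (𝓝 0) := by
  rw [Metric.tendsto_atTop]
  intro e he
  have htail := tendsto_sum_nat_add fun k => inner ℝ (G k (T k)) (T k)
  obtain ⟨s, hs⟩ := ((htail.const_mul μ).eventually_lt_const
    (show μ * 0 < (e / 2) ^ 2 by simp; positivity)).exists
  -- A homogeneous solution launched from `u s` at time `s`, frozen before that. Its difference from
  -- `u` starts at zero and is fed only by the forcing after `s`, whose weighted energy is below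
  -- (e/2)².
  set v : ℕ → H := fun k => Nat.rec (u s) (fun k w => if k < s then w else w - μ • G k w) k
    with hv
  have hvle : ∀ k, k ≤ s → v k = u s := by
    intro k hk
    induction k with
    | zero => rfl
    | succ k ih =>
      have : v (k + 1) = if k < s then v k else v k - μ • G k (v k) := rfl
      rw [this, if_pos (by omega), ih (by omega)]
  have hvrec : ∀ k, s ≤ k → v (k + 1) = v k - μ • G k (v k) := by
    intro k hk
    have : v (k + 1) = if k < s then v k else v k - μ • G k (v k) := rfl
    rw [this, if_neg (by omega)]
  have hdiff : ∀ j, ‖u (s + j) - v (s + j)‖ ^ 2 ≤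
      μ * ∑ i ∈ Finset.range j, inner ℝ (G (i + s) (T (i + s))) (T (i + s)) := by
    intro j
    induction j with
    | zero => simp [hvle s le_rfl]
    | succ j ih =>
      have e1 : u (s + j + 1) - v (s + j + 1) = (u (s + j) - v (s + j))
          - μ • G (s + j) ((u (s + j) - v (s + j)) + T (s + j)) := by
        rw [hu, hvrec _ (by omega)]
        simp only [map_add, map_sub, smul_add, smul_sub]; abel
      rw [← add_assoc, e1, Finset.sum_range_succ, mul_add, add_comm j s]
      exact ((hG _).norm_step_sq_le_add hμ (hb _) _ _).trans (by linarith)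
  obtain ⟨k₁, hk₁⟩ := Metric.tendsto_atTop.1 (hhom v s hvrec) (e / 2) (by positivity)
  refine ⟨max s k₁, fun k hk => ?_⟩
  obtain ⟨j, rfl⟩ : ∃ j, k = s + j := ⟨k - s, by have := le_max_left s k₁; omega⟩
  have h1 := hk₁ (s + j) ((le_max_right _ _).trans hk)
  rw [dist_zero_right] at h1 ⊢
  have h2 : ‖u (s + j) - v (s + j)‖ < e / 2 := by
    refine lt_of_pow_lt_pow_left₀ 2 (by positivity) ((hdiff j).trans_lt (lt_of_le_of_lt ?_ hs))
    refine mul_le_mul_of_nonneg_left ?_ hμ.le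
    exact ((summable_nat_add_iff s).2 hT).sum_le_tsum _ fun i _ => (hG _).2 _
  calc ‖u (s + j)‖ = ‖(u (s + j) - v (s + j)) + v (s + j)‖ := by rw [sub_add_cancel]
    _ ≤ _ := norm_add_le _ _
    _ < e := by linarith

end Recursion

/-! ### Tails of weighted series and a telescoping comparison -/

section Series

/-- Summation by parts: if the partial sums of `y` are bounded by `C` and `a` decreases to zero,
then `∑ a_j y_j` converges, and its remainders are at most `2 C a_k`. -/
theorem exists_tail_of_bounded_partial_sums {H : Type*} [NormedAddCommGroup H] [NormedSpace ℝ H]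
    [CompleteSpace H] {y : ℕ → H} {C : ℝ} (hC : ∀ k, ‖∑ j ∈ Finset.range k, y j‖ ≤ C)
    {a : ℕ → ℝ} (ha : Antitone a) (ha0 : Tendsto a atTop (𝓝 0)) :
    ∃ T : ℕ → H, (∀ k, T k = a k • y k + T (k + 1)) ∧ (∀ k, ‖T k‖ ≤ 2 * C * a k) := by
  set Y : ℕ → H := fun k => ∑ j ∈ Finset.range k, y j with hY
  have hYs : ∀ k, y k = Y (k + 1) - Y k := fun k => by simp [hY, Finset.sum_range_succ]
  have hapos : ∀ k, 0 ≤ a k := fun k => ha.le_of_tendsto ha0 k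
  set Z : ℕ → H := fun k => ∑ j ∈ Finset.range k, a j • y j with hZ
  have hpart : ∀ k l, k ≤ l → ‖Z l - Z k - a l • Y l + a k • Y k‖ ≤ C * (a k - a l) := by
    intro k l hkl
    induction l, hkl using Nat.le_induction with
    | base => simp
    | succ l hkl ih =>
      have e : Z (l + 1) - Z k - a (l + 1) • Y (l + 1) + a k • Y k =
          (Z l - Z k - a l • Y l + a k • Y k) + (a l - a (l + 1)) • Y (l + 1) := by
        have : Z (l + 1) = Z l + a l • y l := by simp [hZ, Finset.sum_range_succ]
        rw [this, hYs, smul_sub, sub_smul]; abel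
      rw [e]
      refine (norm_add_le _ _).trans ?_
      have h0 : 0 ≤ a l - a (l + 1) := sub_nonneg.2 (ha l.le_succ)
      have h1 : ‖(a l - a (l + 1)) • Y (l + 1)‖ ≤ (a l - a (l + 1)) * C := by
        rw [norm_smul, Real.norm_of_nonneg h0]
        exact mul_le_mul_of_nonneg_left (hC _) h0
      linarith
  have hbound : ∀ k l, k ≤ l → ‖Z l - Z k‖ ≤ 2 * C * a k := by
    intro k l hkl
    have e : Z l - Z k = (Z l - Z k - a l • Y l + a k • Y k) + (a l • Y l - a k • Y k) := by abel
    have hn : ∀ j, ‖a j • Y j‖ ≤ a j * C := fun j => by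
      rw [norm_smul, Real.norm_of_nonneg (hapos j)]
      exact mul_le_mul_of_nonneg_left (hC _) (hapos j)
    rw [e]
    refine (norm_add_le _ _).trans ?_
    have := norm_sub_le (a l • Y l) (a k • Y k)
    linarith [hpart k l hkl, hn k, hn l]
  have hcauchy : CauchySeq Z := by
    refine cauchySeq_of_le_tendsto_0' (fun k => 2 * C * a k) (fun k l hkl => ?_) ?_
    · rw [dist_comm, dist_eq_norm]; exact hbound k l hkl
    · simpa using ha0.const_mul (2 * C)
  obtain ⟨z, hz⟩ := cauchySeq_tendsto_of_complete hcauchy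
  refine ⟨fun k => z - Z k, fun k => ?_, fun k => ?_⟩
  · simp only [hZ, Finset.sum_range_succ]; abel
  · exact le_of_tendsto (hz.sub_const (Z k)).norm
      ((eventually_ge_atTop k).mono fun l hl => hbound k l hl)

/-- Each term is at most η⁻¹ (s_k^{-η} - s_{k+1}^{-η}), which telescopes. The larger endpoint in the
denominator makes a bound on s_{k+1}/s_k unnecessary. -/
theorem summable_sub_div_rpow {s : ℕ → ℝ} (hs : Monotone s) (hpos : ∀ k, 0 < s k) {η : ℝ}
    (hη : 0 < η) : Summable fun k => (s (k + 1) - s k) / s (k + 1) ^ (1 + η) := by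
  have hterm : ∀ k, (s (k + 1) - s k) / s (k + 1) ^ (1 + η) ≤
      η⁻¹ * (s k ^ (-η) - s (k + 1) ^ (-η)) := by
    intro k
    set a := s k
    set b := s (k + 1)
    have ha : 0 < a := hpos k
    have hb : 0 < b := hpos (k + 1)
    have h1 : 1 + η * (1 - a / b) ≤ (a / b) ^ (-η) := by
      rw [Real.rpow_def_of_pos (by positivity)]
      have h2 := Real.add_one_le_exp (Real.log (a / b) * -η)
      have h3 := Real.log_le_sub_one_of_pos (div_pos ha hb)
      nlinarith
    have h4 : (a / b) ^ (-η) = a ^ (-η) * b ^ η := by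
      rw [Real.div_rpow ha.le hb.le, Real.rpow_neg hb.le, div_inv_eq_mul]
    have hbη : 0 < b ^ η := Real.rpow_pos_of_pos hb _
    rw [Real.rpow_add hb, Real.rpow_one, Real.rpow_neg hb.le η, le_inv_mul_iff₀ hη]
    rw [h4] at h1
    have e1 : η * ((b - a) / (b * b ^ η)) = (η * (1 - a / b)) / b ^ η := by field_simp
    rw [e1, div_le_iff₀ hbη, sub_mul, inv_mul_cancel₀ hbη.ne']
    linarith
  refine summable_of_sum_range_le (c := η⁻¹ * s 0 ^ (-η)) (fun k => ?_) (fun n => ?_)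
  · exact div_nonneg (sub_nonneg.2 (hs k.le_succ)) (Real.rpow_nonneg (hpos _).le _)
  · refine (Finset.sum_le_sum fun k _ => hterm k).trans ?_
    rw [← Finset.mul_sum, Finset.sum_range_sub']
    have := Real.rpow_nonneg (hpos n).le (-η)
    have hη' := inv_pos.2 hη
    nlinarith

end Series

/-! ### Diffusion on the network -/

namespace SensorNetwork

variable {n : ℕ} (S : SensorNetwork n)

theorem a_nonneg (i j : Fin n) : 0 ≤ S.a i j := by
  by_cases h : i = j ∨ S.graph.Adj i j
  · exact (S.pos i j h).le
  · exact (S.zero i j h).ge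

theorem a_comm (i j : Fin n) : S.a i j = S.a j i := S.symm.apply j i

theorem sum_nbr {M : Type*} [AddCommGroup M] [Module ℝ M] (i : Fin n) (f : Fin n → M) :
    ∑ j ∈ S.nbr i, S.a i j • f j = ∑ j, S.a i j • f j := by
  refine Finset.sum_subset (Finset.subset_univ _) fun j _ hj => ?_
  rw [S.zero i j (by simpa [nbr] using hj), zero_smul]

theorem diffuse_succ (x : Fin n → ℝ) (q : ℕ) (i : Fin n) :
    S.diffuse x (q + 1) i = ∑ j, S.a i j * S.diffuse x q j :=
  S.sum_nbr i (S.diffuse x q)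

theorem diffuse_nonneg {x : Fin n → ℝ} (hx : ∀ i, 0 ≤ x i) (q : ℕ) (i : Fin n) :
    0 ≤ S.diffuse x q i := by
  induction q generalizing i with
  | zero => exact hx i
  | succ q ih =>
    rw [diffuse_succ]
    exact Finset.sum_nonneg fun j _ => mul_nonneg (S.a_nonneg i j) (ih j)

theorem diffuse_le {x : Fin n → ℝ} {b : ℝ} (hx : ∀ i, x i ≤ b) (q : ℕ) (i : Fin n) :
    S.diffuse x q i ≤ b := by
  induction q generalizing i with
  | zero => exact hx i
  | succ q ih =>
    rw [diffuse_succ]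
    calc ∑ j, S.a i j * S.diffuse x q j ≤ ∑ j, S.a i j * b :=
          Finset.sum_le_sum fun j _ => mul_le_mul_of_nonneg_left (ih j) (S.a_nonneg i j)
      _ = b := by rw [← Finset.sum_mul, S.row_sum, one_mul]

/-- Along a walk of length at most `q`, diffusion transports a positive share. -/
theorem exists_pos_mul_le_diffuse_of_walk {i j : Fin n} (p : S.graph.Walk i j) (q : ℕ)
    (hq : p.length ≤ q) :
    ∃ α : ℝ, 0 < α ∧ ∀ x : Fin n → ℝ, (∀ i, 0 ≤ x i) → α * x j ≤ S.diffuse x q i := by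
  have hstep : ∀ (x : Fin n → ℝ), (∀ i, 0 ≤ x i) → ∀ q i k,
      S.a i k * S.diffuse x q k ≤ S.diffuse x (q + 1) i := by
    intro x hx q i k
    rw [diffuse_succ]
    exact Finset.single_le_sum (f := fun k => S.a i k * S.diffuse x q k)
      (fun k _ => mul_nonneg (S.a_nonneg i k) (S.diffuse_nonneg hx q k)) (Finset.mem_univ k)
  induction q generalizing i with
  | zero =>
    obtain rfl := SimpleGraph.Walk.eq_of_length_eq_zero (Nat.le_zero.1 hq)
    exact ⟨1, one_pos, fun x _ => by simp [diffuse]⟩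
  | succ q ih =>
    cases p with
    | nil =>
      obtain ⟨α, hα, h⟩ := ih SimpleGraph.Walk.nil (by simp)
      refine ⟨S.a j j * α, mul_pos (S.pos j j (Or.inl rfl)) hα, fun x hx => ?_⟩
      rw [mul_assoc]
      exact (mul_le_mul_of_nonneg_left (h x hx) (S.a_nonneg j j)).trans (hstep x hx q j j)
    | @cons _ k _ hadj p =>
      obtain ⟨α, hα, h⟩ := ih p (by simpa using hq)
      refine ⟨S.a i k * α, mul_pos (S.pos i k (Or.inr hadj)) hα, fun x hx => ?_⟩
      rw [mul_assoc]
      exact (mul_le_mul_of_nonneg_left (h x hx) (S.a_nonneg i k)).trans (hstep x hx q i k)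

/-- After at least `diam` rounds every sensor holds a fixed share of the total. -/
theorem exists_pos_mul_sum_le_diffuse (hconn : S.graph.Connected) {Q : ℕ}
    (hQ : S.graph.diam ≤ Q) :
    ∃ α : ℝ, 0 < α ∧ ∀ x : Fin n → ℝ, (∀ i, 0 ≤ x i) → ∀ i,
      α * ∑ j, x j ≤ S.diffuse x Q i := by
  have : Nonempty (Fin n) := hconn.nonempty
  have h : ∀ p : Fin n × Fin n, ∃ α : ℝ, 0 < α ∧ ∀ x : Fin n → ℝ, (∀ i, 0 ≤ x i) →
      α * x p.2 ≤ S.diffuse x Q p.1 := by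
    rintro ⟨i, j⟩
    obtain ⟨p, hp⟩ := hconn.exists_walk_length_eq_dist i j
    refine S.exists_pos_mul_le_diffuse_of_walk p Q ?_
    rw [hp]
    exact (SimpleGraph.dist_le_diam (SimpleGraph.connected_iff_ediam_ne_top.1 hconn)).trans hQ
  choose α hα hle using h
  obtain ⟨p₀, hp₀⟩ := Finite.exists_min α
  have hn : (0 : ℝ) < n := by exact_mod_cast Fin.pos_iff_nonempty.2 inferInstance
  refine ⟨α p₀ / n, div_pos (hα p₀) hn, fun x hx i => ?_⟩
  have hsum : ∑ j, α p₀ * x j ≤ ∑ _j : Fin n, S.diffuse x Q i :=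
    Finset.sum_le_sum fun j _ =>
      (mul_le_mul_of_nonneg_right (hp₀ (i, j)) (hx j)).trans (hle (i, j) x hx)
  rw [← Finset.mul_sum, Finset.sum_const, Finset.card_univ, Fintype.card_fin, nsmul_eq_mul] at hsum
  rw [div_mul_eq_mul_div, div_le_iff₀ hn]
  linarith

/-! ### Laplacian, spectral gap and gain operator -/

section Laplacian

variable {E : Type*} [NormedAddCommGroup E] [InnerProductSpace ℝ E]

/-- The Laplacian `I - A` of the network, acting on `E`-valued functions. -/
noncomputable def lap : PiLp 2 (fun _ : Fin n => E) →ₗ[ℝ] PiLp 2 (fun _ : Fin n => E) where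
  toFun v := WithLp.toLp 2 fun i => v i - ∑ j, S.a i j • v j
  map_add' v w := by
    ext i
    simp only [PiLp.add_apply, smul_add, Finset.sum_add_distrib]
    abel
  map_smul' c v := by
    ext i
    simp only [PiLp.smul_apply, smul_sub, Finset.smul_sum, smul_comm c, RingHom.id_apply]

theorem lap_apply (v : PiLp 2 (fun _ : Fin n => E)) (i : Fin n) :
    S.lap v i = v i - ∑ j, S.a i j • v j := rfl

theorem lap_apply_eq_sum (v : PiLp 2 (fun _ : Fin n => E)) (i : Fin n) :
    S.lap v i = ∑ j ∈ S.nbr i, S.a i j • (v i - v j) := by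
  rw [S.sum_nbr i fun j => v i - v j, lap_apply]
  simp only [smul_sub, Finset.sum_sub_distrib]
  rw [← Finset.sum_smul, S.row_sum, one_smul]

theorem inner_lap (v w : PiLp 2 (fun _ : Fin n => E)) :
    inner ℝ (S.lap v) w = ∑ i, inner ℝ (v i) (w i) - ∑ i, ∑ j, S.a i j * inner ℝ (v j) (w i) := by
  simp only [PiLp.inner_apply, lap_apply, inner_sub_left, sum_inner, inner_smul_left,
    Finset.sum_sub_distrib, conj_trivial]

theorem lap_symm (v w : PiLp 2 (fun _ : Fin n => E)) :
    inner ℝ (S.lap v) w = inner ℝ v (S.lap w) := by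
  rw [← real_inner_comm v, inner_lap, inner_lap, Finset.sum_comm (γ := Fin n)]
  congr 1
  · exact Finset.sum_congr rfl fun i _ => real_inner_comm _ _
  · exact Finset.sum_congr rfl fun i _ => Finset.sum_congr rfl fun j _ => by
      rw [S.a_comm, real_inner_comm]

theorem two_mul_inner_lap_self (v : PiLp 2 (fun _ : Fin n => E)) :
    2 * inner ℝ (S.lap v) v = ∑ i, ∑ j, S.a i j * ‖v i - v j‖ ^ 2 := by
  have h1 : ∑ i, ∑ j, S.a i j * ‖v i‖ ^ 2 = ∑ i, ‖v i‖ ^ 2 :=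
    Finset.sum_congr rfl fun i _ => by rw [← Finset.sum_mul, S.row_sum, one_mul]
  have h2 : ∑ i, ∑ j, S.a i j * ‖v j‖ ^ 2 = ∑ i, ‖v i‖ ^ 2 := by
    rw [Finset.sum_comm, ← h1]
    exact Finset.sum_congr rfl fun i _ => Finset.sum_congr rfl fun j _ => by rw [S.a_comm]
  have e : ∀ i j, S.a i j * ‖v i - v j‖ ^ 2 =
      S.a i j * ‖v i‖ ^ 2 + S.a i j * ‖v j‖ ^ 2 - 2 * (S.a i j * inner ℝ (v j) (v i)) := by
    intro i j
    rw [norm_sub_sq_real, real_inner_comm]; ring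
  simp only [e, Finset.sum_sub_distrib, Finset.sum_add_distrib, h1, h2, ← Finset.mul_sum,
    inner_lap, real_inner_self_eq_norm_sq]
  ring

/-- The Dirichlet form and ‖a - b‖² ≤ 2‖a‖² + 2‖b‖² give 0 ≤ L ≤ 2; then L² ≤ 2L ≤ 4. -/
theorem norm_lap_sq_le (v : PiLp 2 (fun _ : Fin n => E)) : ‖S.lap v‖ ^ 2 ≤ 4 * ‖v‖ ^ 2 := by
  have hsymm : IsSymmNonneg (S.lap (E := E)) := by
    refine ⟨S.lap_symm, fun v => ?_⟩
    have := S.two_mul_inner_lap_self v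
    have h0 : 0 ≤ ∑ i, ∑ j, S.a i j * ‖v i - v j‖ ^ 2 :=
      Finset.sum_nonneg fun i _ => Finset.sum_nonneg fun j _ =>
        mul_nonneg (S.a_nonneg i j) (sq_nonneg _)
    linarith
  have hub : ∀ v : PiLp 2 (fun _ : Fin n => E), inner ℝ (S.lap v) v ≤ 2 * ‖v‖ ^ 2 := by
    intro v
    have h1 : ∑ i, ∑ j, S.a i j * ‖v i‖ ^ 2 = ‖v‖ ^ 2 := by
      rw [PiLp.norm_sq_eq_of_L2]
      exact Finset.sum_congr rfl fun i _ => by rw [← Finset.sum_mul, S.row_sum, one_mul]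
    have h2 : ∑ i, ∑ j, S.a i j * ‖v j‖ ^ 2 = ‖v‖ ^ 2 := by
      rw [Finset.sum_comm, ← h1]
      exact Finset.sum_congr rfl fun i _ => Finset.sum_congr rfl fun j _ => by rw [S.a_comm]
    have h3 : ∑ i, ∑ j, S.a i j * ‖v i - v j‖ ^ 2 ≤
        ∑ i, ∑ j, (2 * (S.a i j * ‖v i‖ ^ 2) + 2 * (S.a i j * ‖v j‖ ^ 2)) := by
      refine Finset.sum_le_sum fun i _ => Finset.sum_le_sum fun j _ => ?_
      have h := norm_sub_le (v i) (v j)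
      have h' : ‖v i - v j‖ ^ 2 ≤ 2 * ‖v i‖ ^ 2 + 2 * ‖v j‖ ^ 2 := by
        nlinarith [norm_nonneg (v i - v j), sq_nonneg (‖v i‖ - ‖v j‖)]
      nlinarith [mul_le_mul_of_nonneg_left h' (S.a_nonneg i j)]
    simp only [Finset.sum_add_distrib, ← Finset.mul_sum] at h3
    rw [h1, h2, ← two_mul_inner_lap_self] at h3
    linarith
  have := hsymm.norm_map_sq_le zero_le_two hub v
  linarith [hub v]

theorem eq_of_lap_eq_zero (hconn : S.graph.Connected) {v : PiLp 2 (fun _ : Fin n => E)}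
    (hv : S.lap v = 0) (i j : Fin n) : v i = v j := by
  have h0 : ∑ i, ∑ j, S.a i j * ‖v i - v j‖ ^ 2 = 0 := by
    rw [← two_mul_inner_lap_self, hv]; simp
  have hnn : ∀ i j, 0 ≤ S.a i j * ‖v i - v j‖ ^ 2 := fun i j =>
    mul_nonneg (S.a_nonneg i j) (sq_nonneg _)
  have hadj : ∀ i j, S.graph.Adj i j → v i = v j := by
    intro i j hij
    have h1 := (Finset.sum_eq_zero_iff_of_nonneg
      fun i _ => Finset.sum_nonneg fun j _ => hnn i j).1 h0 i (Finset.mem_univ i)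
    have h2 := (Finset.sum_eq_zero_iff_of_nonneg fun j _ => hnn i j).1 h1 j (Finset.mem_univ j)
    rcases mul_eq_zero.1 h2 with h | h
    · exact absurd h (S.pos i j (Or.inr hij)).ne'
    · rwa [pow_eq_zero_iff two_ne_zero, norm_eq_zero, sub_eq_zero] at h
  obtain ⟨p⟩ := hconn.preconnected i j
  induction p with
  | nil => rfl
  | cons h p ih => exact (hadj _ _ h).trans ih

/-- The average over the network. -/
noncomputable def avg (v : PiLp 2 (fun _ : Fin n => E)) : E := (n : ℝ)⁻¹ • ∑ i, v i

/-- Spectral gap of a connected network. -/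
theorem exists_pos_mul_sum_norm_sub_avg_le [FiniteDimensional ℝ E] (hconn : S.graph.Connected) :
    ∃ c : ℝ, 0 < c ∧ ∀ v : PiLp 2 (fun _ : Fin n => E),
      c * ∑ i, ‖v i - avg v‖ ^ 2 ≤ ‖S.lap v‖ ^ 2 := by
  have : Nonempty (Fin n) := hconn.nonempty
  have hn : (n : ℝ) ≠ 0 := by exact_mod_cast (Fin.pos_iff_nonempty.2 inferInstance : 0 < n).ne'
  let tot : PiLp 2 (fun _ : Fin n => E) →ₗ[ℝ] E :=
    { toFun := fun v => ∑ i, v i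
      map_add' := fun v w => by simp [Finset.sum_add_distrib]
      map_smul' := fun c v => by simp [Finset.smul_sum] }
  -- The kernel of L consists of constant vectors, and the total detects those, so the pair is
  -- injective and, in finite dimension, bounded below. On centred vectors the total vanishes,
  -- leaving a bound by L alone.
  let f : PiLp 2 (fun _ : Fin n => E) →ₗ[ℝ] PiLp 2 (fun _ : Fin n => E) × E := S.lap.prod tot
  have hinj : LinearMap.ker f = ⊥ := by
    rw [LinearMap.ker_eq_bot']
    intro v hv
    have h1 : S.lap v = 0 := congrArg Prod.fst hv
    have h2 : ∑ i, v i = 0 := congrArg Prod.snd hv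
    ext1 i
    have h3 : ∑ j, v j = (n : ℝ) • v i := by
      rw [Finset.sum_congr rfl fun j _ => S.eq_of_lap_eq_zero hconn h1 j i, Finset.sum_const,
        Finset.card_univ, Fintype.card_fin, Nat.cast_smul_eq_nsmul]
    rw [h3] at h2
    exact (smul_eq_zero.1 h2).resolve_left hn
  obtain ⟨K, hK, hanti⟩ := f.exists_antilipschitzWith hinj
  have hK' : (0 : ℝ) < K := hK
  refine ⟨((K : ℝ) ^ 2)⁻¹, by positivity, fun v => ?_⟩
  set w : PiLp 2 (fun _ : Fin n => E) := WithLp.toLp 2 fun i => v i - avg v with hw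
  have hlap : S.lap w = S.lap v := by
    ext1 i
    simp only [lap_apply, hw, smul_sub, Finset.sum_sub_distrib]
    rw [← Finset.sum_smul, S.row_sum, one_smul]
    abel
  have htot : tot w = 0 := by
    change ∑ i, (v i - avg v) = 0
    rw [Finset.sum_sub_distrib, Finset.sum_const, Finset.card_univ, Fintype.card_fin, avg,
      ← Nat.cast_smul_eq_nsmul ℝ, smul_inv_smul₀ hn, sub_self]
  have h1 := hanti.le_mul_norm (map_zero f) w
  have h2 : ‖f w‖ = ‖S.lap v‖ := by
    have : f w = (S.lap v, 0) := Prod.ext hlap htot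
    rw [this, Prod.norm_mk, norm_zero, max_eq_left (norm_nonneg _)]
  have h3 : ‖w‖ ^ 2 = ∑ i, ‖v i - avg v‖ ^ 2 := PiLp.norm_sq_eq_of_L2 _ _
  rw [← h3, inv_mul_le_iff₀ (by positivity), ← mul_pow, ← h2]
  gcongr

/-- Pythagoras: constant vectors are orthogonal to vectors of total zero. -/
theorem sum_norm_sq_eq_avg (v : PiLp 2 (fun _ : Fin n => E)) :
    ‖v‖ ^ 2 = n * ‖avg v‖ ^ 2 + ∑ i, ‖v i - avg v‖ ^ 2 := by
  rcases Nat.eq_zero_or_pos n with rfl | hn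
  · rw [PiLp.norm_sq_eq_of_L2]; simp
  have hn' : (n : ℝ) ≠ 0 := by exact_mod_cast hn.ne'
  have h1 : ∑ i, v i = (n : ℝ) • avg v := by rw [avg, smul_inv_smul₀ hn']
  have h2 : ∑ i, inner ℝ (v i) (avg v) = n * ‖avg v‖ ^ 2 := by
    rw [← sum_inner, h1, inner_smul_left, real_inner_self_eq_norm_sq]; simp
  simp only [norm_sub_sq_real, Finset.sum_add_distrib, Finset.sum_sub_distrib, ← Finset.mul_sum,
    h2, PiLp.norm_sq_eq_of_L2, Finset.sum_const, Finset.card_univ, Fintype.card_fin, nsmul_eq_mul]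
  ring

/-- The gain operator `F + ν L X L` of the algorithm. -/
noncomputable def gain (ν : ℝ) (φ : Fin n → E) (r x : Fin n → ℝ) :
    PiLp 2 (fun _ : Fin n => E) →ₗ[ℝ] PiLp 2 (fun _ : Fin n => E) :=
  { toFun := fun v => WithLp.toLp 2 fun i => (inner ℝ (φ i) (v i) / r i) • φ i
    map_add' := fun v w => by
      ext1 i; simp only [PiLp.add_apply, inner_add_right, add_div, add_smul]
    map_smul' := fun c v => by
      ext1 i
      simp only [PiLp.smul_apply, inner_smul_right, mul_div_assoc, mul_smul, RingHom.id_apply] } +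
  ν • S.lap ∘ₗ
    { toFun := fun v => WithLp.toLp 2 fun i => x i • v i
      map_add' := fun v w => by ext1 i; simp only [PiLp.add_apply, smul_add]
      map_smul' := fun c v => by
        ext1 i; simp only [PiLp.smul_apply, smul_comm c, RingHom.id_apply] } ∘ₗ S.lap

theorem gain_apply (ν : ℝ) (φ : Fin n → E) (r x : Fin n → ℝ)
    (v : PiLp 2 (fun _ : Fin n => E)) (i : Fin n) :
    S.gain ν φ r x v i = (inner ℝ (φ i) (v i) / r i) • φ i +
      ν • S.lap (WithLp.toLp 2 fun j => x j • S.lap v j) i := rfl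

theorem inner_gain (ν : ℝ) (φ : Fin n → E) (r x : Fin n → ℝ)
    (v w : PiLp 2 (fun _ : Fin n => E)) :
    inner ℝ (S.gain ν φ r x v) w =
      ∑ i, inner ℝ (φ i) (v i) * inner ℝ (φ i) (w i) / r i +
        ν * ∑ i, x i * inner ℝ (S.lap v i) (S.lap w i) := by
  have h : S.gain ν φ r x v = (WithLp.toLp 2 fun i => (inner ℝ (φ i) (v i) / r i) • φ i) +
      ν • S.lap (WithLp.toLp 2 fun j => x j • S.lap v j) := rfl
  rw [h, inner_add_left, inner_smul_left, lap_symm]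
  simp only [PiLp.inner_apply, inner_smul_left, conj_trivial]
  congr 1
  exact Finset.sum_congr rfl fun i _ => by ring

theorem isSymmNonneg_gain {ν : ℝ} (hν : 0 ≤ ν) (φ : Fin n → E) {r x : Fin n → ℝ}
    (hr : ∀ i, 0 < r i) (hx : ∀ i, 0 ≤ x i) : IsSymmNonneg (S.gain ν φ r x) := by
  refine ⟨fun v w => ?_, fun v => ?_⟩
  · rw [← real_inner_comm v, inner_gain, inner_gain]
    congr 1
    · exact Finset.sum_congr rfl fun i _ => by ring
    · congr 1
      exact Finset.sum_congr rfl fun i _ => by rw [real_inner_comm]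
  · rw [inner_gain]
    refine add_nonneg (Finset.sum_nonneg fun i _ => div_nonneg (mul_self_nonneg _) (hr i).le)
      (mul_nonneg hν (Finset.sum_nonneg fun i _ => mul_nonneg (hx i) real_inner_self_nonneg))

/-- The regressor part contributes β and the part L X L contributes 4νβ through ‖L v‖² ≤ 4‖v‖²; this
is the origin of the step size condition on μ(1 + 4ν). -/
theorem inner_gain_self_le {ν : ℝ} (hν : 0 ≤ ν) (φ : Fin n → E) {r x : Fin n → ℝ}
    (hr : ∀ i, 0 < r i) {β : ℝ} (hφ : ∀ i, ‖φ i‖ ^ 2 / r i ≤ β) (hx : ∀ i, x i ≤ β)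
    (hβ : 0 ≤ β) (v : PiLp 2 (fun _ : Fin n => E)) :
    inner ℝ (S.gain ν φ r x v) v ≤ β * (1 + 4 * ν) * ‖v‖ ^ 2 := by
  rw [inner_gain]
  have h1 : ∑ i, inner ℝ (φ i) (v i) * inner ℝ (φ i) (v i) / r i ≤ β * ‖v‖ ^ 2 := by
    rw [PiLp.norm_sq_eq_of_L2, Finset.mul_sum]
    refine Finset.sum_le_sum fun i _ => ?_
    refine le_trans ?_ (mul_le_mul_of_nonneg_right (hφ i) (sq_nonneg ‖v i‖))
    rw [div_mul_eq_mul_div]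
    refine div_le_div_of_nonneg_right ?_ (hr i).le
    have := abs_real_inner_le_norm (φ i) (v i)
    calc inner ℝ (φ i) (v i) * inner ℝ (φ i) (v i) = |inner ℝ (φ i) (v i)| ^ 2 := by
          rw [sq_abs, sq]
      _ ≤ (‖φ i‖ * ‖v i‖) ^ 2 := by gcongr
      _ = _ := mul_pow _ _ _
  have h2 : ∑ i, x i * inner ℝ (S.lap v i) (S.lap v i) ≤ β * ‖S.lap v‖ ^ 2 := by
    rw [PiLp.norm_sq_eq_of_L2, Finset.mul_sum]
    refine Finset.sum_le_sum fun i _ => ?_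
    rw [real_inner_self_eq_norm_sq]
    exact mul_le_mul_of_nonneg_right (hx i) (sq_nonneg _)
  have h3 := mul_le_mul_of_nonneg_left (S.norm_lap_sq_le v) hβ
  have h4 := mul_le_mul_of_nonneg_left (h2.trans h3) hν
  linarith

/-- The gain operator excites the average like the regressors do, and the disagreement like the
total normalized energy. -/
theorem exists_pos_mul_le_inner_gain [FiniteDimensional ℝ E] (hconn : S.graph.Connected) {Q : ℕ}
    (hQ : S.graph.diam ≤ Q) {ν : ℝ} (hν : 0 < ν) :
    ∃ c : ℝ, 0 < c ∧ ∀ (φ : Fin n → E) (r : Fin n → ℝ), (∀ i, 0 < r i) →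
      ∀ v : PiLp 2 (fun _ : Fin n => E),
      c * (∑ i, inner ℝ (φ i) (avg v) ^ 2 / r i +
        (∑ i, ‖φ i‖ ^ 2 / r i) * ∑ i, ‖v i - avg v‖ ^ 2) ≤
      inner ℝ (S.gain ν φ r (S.diffuse (fun i => ‖φ i‖ ^ 2 / r i) Q) v) v := by
  obtain ⟨α, hα, hdiff⟩ := S.exists_pos_mul_sum_le_diffuse hconn hQ
  obtain ⟨c₁, hc₁, hgap⟩ := S.exists_pos_mul_sum_norm_sub_avg_le (E := E) hconn
  set β := ν * (α * c₁) with hβ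
  have hβ0 : 0 < β := by positivity
  -- Replacing each v_i by the average costs at most 2bΔ beyond 2F. With the disagreement term this
  -- makes 2F + 3bΔ, and 3/β converts βbΔ, the guaranteed part of the Laplacian term, into 3bΔ.
  refine ⟨(2 + 3 / β)⁻¹, by positivity, fun φ r hr v => ?_⟩
  set b := ∑ i, ‖φ i‖ ^ 2 / r i with hb
  set Δ := ∑ i, ‖v i - avg v‖ ^ 2 with hΔ
  set F := ∑ i, inner ℝ (φ i) (v i) * inner ℝ (φ i) (v i) / r i with hF
  have hx0 : ∀ i, 0 ≤ ‖φ i‖ ^ 2 / r i := fun i => div_nonneg (sq_nonneg _) (hr i).le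
  have hb0 : 0 ≤ b := Finset.sum_nonneg fun i _ => hx0 i
  have hΔ0 : 0 ≤ Δ := Finset.sum_nonneg fun i _ => sq_nonneg _
  have hF0 : 0 ≤ F := Finset.sum_nonneg fun i _ => div_nonneg (mul_self_nonneg _) (hr i).le
  have h1 : ∑ i, inner ℝ (φ i) (avg v) ^ 2 / r i ≤ 2 * F + 2 * (b * Δ) := by
    have hle : ∀ i, inner ℝ (φ i) (avg v) ^ 2 / r i ≤
        2 * (inner ℝ (φ i) (v i) * inner ℝ (φ i) (v i) / r i) +
          2 * (‖φ i‖ ^ 2 / r i * Δ) := by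
      intro i
      have e1 : inner ℝ (φ i) (avg v) = inner ℝ (φ i) (v i) - inner ℝ (φ i) (v i - avg v) := by
        rw [inner_sub_right]; ring
      have e2 : inner ℝ (φ i) (v i - avg v) ^ 2 ≤ ‖φ i‖ ^ 2 * Δ := by
        have h := abs_real_inner_le_norm (φ i) (v i - avg v)
        calc inner ℝ (φ i) (v i - avg v) ^ 2 = |inner ℝ (φ i) (v i - avg v)| ^ 2 := (sq_abs _).symm
          _ ≤ (‖φ i‖ * ‖v i - avg v‖) ^ 2 := by gcongr
          _ = ‖φ i‖ ^ 2 * ‖v i - avg v‖ ^ 2 := mul_pow _ _ _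
          _ ≤ _ := mul_le_mul_of_nonneg_left (Finset.single_le_sum
            (f := fun i => ‖v i - avg v‖ ^ 2) (fun i _ => sq_nonneg _) (Finset.mem_univ i))
            (sq_nonneg _)
      rw [div_mul_eq_mul_div, mul_div_assoc', mul_div_assoc', ← add_div]
      refine div_le_div_of_nonneg_right ?_ (hr i).le
      rw [e1]
      nlinarith [sq_nonneg (inner ℝ (φ i) (v i) + inner ℝ (φ i) (v i - avg v))]
    refine (Finset.sum_le_sum fun i _ => hle i).trans (le_of_eq ?_)
    rw [Finset.sum_add_distrib, ← Finset.mul_sum, ← Finset.mul_sum, ← Finset.sum_mul]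
  have h2 : β * (b * Δ) ≤ ν * ∑ i, S.diffuse (fun i => ‖φ i‖ ^ 2 / r i) Q i *
      inner ℝ (S.lap v i) (S.lap v i) := by
    have h3 : α * b * ‖S.lap v‖ ^ 2 ≤ ∑ i, S.diffuse (fun i => ‖φ i‖ ^ 2 / r i) Q i *
        inner ℝ (S.lap v i) (S.lap v i) := by
      rw [PiLp.norm_sq_eq_of_L2, Finset.mul_sum]
      refine Finset.sum_le_sum fun i _ => ?_
      rw [real_inner_self_eq_norm_sq]
      exact mul_le_mul_of_nonneg_right (hdiff _ hx0 i) (sq_nonneg _)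
    have h4 := mul_le_mul_of_nonneg_left (hgap v) (mul_nonneg hα.le hb0)
    calc β * (b * Δ) = ν * (α * b * (c₁ * Δ)) := by rw [hβ]; ring
      _ ≤ _ := mul_le_mul_of_nonneg_left (h4.trans h3) hν.le
  rw [inner_gain, inv_mul_le_iff₀ (by positivity)]
  have h5 : (2 + 3 / β) * (F + β * (b * Δ)) = 2 * F + 3 * (b * Δ) + 2 * (β * (b * Δ)) + 3 / β * F := by
    field_simp; ring
  have h6 : (2 + 3 / β) * (F + β * (b * Δ)) ≤ (2 + 3 / β) * (F + ν * ∑ i,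
      S.diffuse (fun i => ‖φ i‖ ^ 2 / r i) Q i * inner ℝ (S.lap v i) (S.lap v i)) := by
    gcongr
  have h7 : 0 ≤ β * (b * Δ) := by positivity
  have h8 : 0 ≤ 3 / β * F := by positivity
  have h9 : 0 ≤ b * Δ := by positivity
  linarith

end Laplacian

end SensorNetwork

/-! ### Logarithmic increments -/

theorem Real.sub_div_le_log_sub_log {a b : ℝ} (ha : 0 < a) (hb : 0 < b) :
    (b - a) / b ≤ Real.log b - Real.log a := by
  have := Real.one_sub_inv_le_log_of_pos (div_pos hb ha)
  rwa [Real.log_div hb.ne' ha.ne', inv_div, one_sub_div hb.ne'] at this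

theorem Real.log_sub_log_le_mul_sub_div {a b ρ : ℝ} (ha : 0 < a) (hab : a ≤ b) (hρ : b ≤ ρ * a) :
    Real.log b - Real.log a ≤ ρ * ((b - a) / b) := by
  have hb := ha.trans_le hab
  rw [← Real.log_div hb.ne' ha.ne']
  refine (Real.log_le_sub_one_of_pos (div_pos hb ha)).trans ?_
  rw [div_sub_one ha.ne', mul_div_assoc', div_le_div_iff₀ ha hb]
  nlinarith [mul_le_mul_of_nonneg_right hρ (sub_nonneg.2 hab)]

/-- Summation by parts for `∑ (p_{k+1} - p_k) / σ_{k+1}` when `p` is comparable to `σ`. -/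
theorem mul_log_sub_le_sum_sub_div {p σ : ℕ → ℝ} (hσ : Monotone σ) (hpos : ∀ k, 0 < σ k)
    {w A ρ : ℝ} (hw : 0 ≤ w) (hA : 0 < A) (hρ : 0 < ρ) {s t : ℕ} (hst : s ≤ t)
    (hp : ∀ k, s ≤ k → k < t → σ k * w ≤ A * p k) (hps : p s ≤ σ s * w) (hpt : 0 ≤ p t)
    (hgrow : ∀ k, s ≤ k → σ (k + 1) ≤ ρ * σ k) :
    w * ((Real.log (σ t) - Real.log (σ s)) / (A * ρ) - 1) ≤
      ∑ k ∈ Finset.Ico s t, (p (k + 1) - p k) / σ (k + 1) := by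
  -- The boundary terms p/σ are carried through the induction. The remaining p_l (1/σ_l - 1/σ_{l+1})
  -- is at least (w/A)(σ_{l+1} - σ_l)/σ_{l+1}, and bounded growth turns that into an increment of
  -- log σ at the price of ρ.
  have key : ∀ l, s ≤ l → l ≤ t →
      w / (A * ρ) * (Real.log (σ l) - Real.log (σ s)) - p s / σ s + p l / σ l ≤
        ∑ k ∈ Finset.Ico s l, (p (k + 1) - p k) / σ (k + 1) := by
    intro l hl
    induction l, hl using Nat.le_induction with
    | base => intro _; simp
    | succ l hl ih =>
      intro hlt
      have ih := ih (by omega)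
      rw [Finset.sum_Ico_succ_top hl]
      have h1 := Real.log_sub_log_le_mul_sub_div (hpos l) (hσ l.le_succ) (hgrow l hl)
      have h2 : w / A * ((σ (l + 1) - σ l) / σ (l + 1)) ≤ p l / σ l - p l / σ (l + 1) := by
        have h3 : w / A ≤ p l / σ l := by
          rw [div_le_div_iff₀ hA (hpos l)]; linarith [hp l hl (by omega)]
        have e : p l / σ l - p l / σ (l + 1) = p l / σ l * ((σ (l + 1) - σ l) / σ (l + 1)) := by
          have := (hpos l).ne'; have := (hpos (l + 1)).ne'; field_simp
        rw [e]
        exact mul_le_mul_of_nonneg_right h3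
          (div_nonneg (sub_nonneg.2 (hσ l.le_succ)) (hpos _).le)
      have h4 : w / (A * ρ) * (Real.log (σ (l + 1)) - Real.log (σ l)) ≤
          w / A * ((σ (l + 1) - σ l) / σ (l + 1)) := by
        calc w / (A * ρ) * (Real.log (σ (l + 1)) - Real.log (σ l))
            ≤ w / (A * ρ) * (ρ * ((σ (l + 1) - σ l) / σ (l + 1))) := by gcongr
          _ = _ := by field_simp
      have h5 : (p (l + 1) - p l) / σ (l + 1) = p (l + 1) / σ (l + 1) - p l / σ (l + 1) := sub_div _ _ _
      rw [h5]
      linarith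
  have h := key t hst le_rfl
  have h1 : p s / σ s ≤ w := by rw [div_le_iff₀ (hpos s)]; linarith
  have h2 : 0 ≤ p t / σ t := div_nonneg hpt (hpos t).le
  calc w * ((Real.log (σ t) - Real.log (σ s)) / (A * ρ) - 1)
      = w / (A * ρ) * (Real.log (σ t) - Real.log (σ s)) - w := by ring
    _ ≤ _ := by linarith

/-! ### Energies, information matrix and error recursion -/

namespace DistributedSG

variable {n m : ℕ} (φ : ℕ → Fin n → EuclideanSpace ℝ (Fin m))

theorem r_succ (k : ℕ) (i : Fin n) : r φ (k + 1) i = r φ k i + ‖φ (k + 1) i‖ ^ 2 := by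
  rw [r, r, Finset.sum_Icc_succ_top (by omega)]; ring

theorem one_le_r (k : ℕ) (i : Fin n) : 1 ≤ r φ k i := by
  have : 0 ≤ ∑ j ∈ Finset.Icc 1 k, ‖φ j i‖ ^ 2 := Finset.sum_nonneg fun _ _ => sq_nonneg _
  rw [r]; linarith

theorem r_pos (k : ℕ) (i : Fin n) : 0 < r φ k i := one_pos.trans_le (one_le_r φ k i)

/-- The total energy `∑_i r^i_k`. -/
noncomputable def totalR (k : ℕ) : ℝ := ∑ i, r φ k i

theorem totalR_succ (k : ℕ) : totalR φ (k + 1) = totalR φ k + ∑ i, ‖φ (k + 1) i‖ ^ 2 := by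
  simp only [totalR, r_succ, Finset.sum_add_distrib]

theorem totalR_monotone : Monotone (totalR φ) :=
  monotone_nat_of_le_succ fun k => by
    rw [totalR_succ]
    linarith [Finset.sum_nonneg fun (i : Fin n) (_ : i ∈ Finset.univ) => sq_nonneg ‖φ (k + 1) i‖]

theorem r_le_totalR (k : ℕ) (i : Fin n) : r φ k i ≤ totalR φ k :=
  Finset.single_le_sum (f := fun i => r φ k i) (fun i _ => (r_pos φ k i).le) (Finset.mem_univ i)

theorem one_le_totalR [Nonempty (Fin n)] (k : ℕ) : 1 ≤ totalR φ k :=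
  (one_le_r φ k (Classical.arbitrary _)).trans (r_le_totalR φ k _)

theorem totalR_pos [Nonempty (Fin n)] (k : ℕ) : 0 < totalR φ k :=
  one_pos.trans_le (one_le_totalR φ k)

theorem normR_eq (k : ℕ) : normR φ k = ‖r φ k‖ := by
  rw [normR, R, Matrix.l2_opNorm_diagonal]

theorem r_le_normR (k : ℕ) (i : Fin n) : r φ k i ≤ normR φ k := by
  rw [normR_eq]; exact (le_abs_self _).trans (norm_le_pi_norm (r φ k) i)

theorem normR_le_totalR (k : ℕ) : normR φ k ≤ totalR φ k := by
  rw [normR_eq]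
  refine (pi_norm_le_iff_of_nonneg
    (Finset.sum_nonneg fun i _ => (r_pos φ k i).le)).2 fun i => ?_
  rw [Real.norm_of_nonneg (r_pos φ k i).le]
  exact r_le_totalR φ k i

theorem one_le_normR [Nonempty (Fin n)] (k : ℕ) : 1 ≤ normR φ k :=
  (one_le_r φ k (Classical.arbitrary _)).trans (r_le_normR φ k _)

/-- Makes every r^i comparable with the total, so a single scalar can serve as the clock for all
sensors. -/
theorem totalR_le_of_condition_number {γ : ℝ} {k : ℕ}
    (h : (⨆ i, r φ k i) / (⨅ i, r φ k i) ≤ γ) (i : Fin n) : totalR φ k ≤ n * γ * r φ k i := by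
  have : Nonempty (Fin n) := ⟨i⟩
  have hinf : 1 ≤ ⨅ i, r φ k i := le_ciInf fun i => one_le_r φ k i
  rw [div_le_iff₀ (by linarith)] at h
  have hle : ∀ j, r φ k j ≤ γ * r φ k i := by
    intro j
    have h1 : r φ k j ≤ ⨆ i, r φ k i := le_ciSup (Finite.bddAbove_range _) j
    have h2 : (⨅ i, r φ k i) ≤ r φ k i := ciInf_le (Finite.bddBelow_range _) i
    have hγ : 0 ≤ γ := by
      by_contra! hneg
      have := one_le_r φ k j
      nlinarith
    exact h1.trans (h.trans (mul_le_mul_of_nonneg_left h2 hγ))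
  calc totalR φ k ≤ ∑ _j : Fin n, γ * r φ k i := Finset.sum_le_sum fun j _ => hle j
    _ = n * γ * r φ k i := by simp [mul_assoc]

section Info

/-- The quadratic form of the information matrix. -/
noncomputable def infoForm (k : ℕ) (v : EuclideanSpace ℝ (Fin m)) : ℝ :=
  (n : ℝ) / m * ‖v‖ ^ 2 + ∑ i, ∑ j ∈ Finset.Icc 1 k, inner ℝ (φ j i) v ^ 2

theorem infoForm_succ (k : ℕ) (v : EuclideanSpace ℝ (Fin m)) :
    infoForm φ (k + 1) v = infoForm φ k v + ∑ i, inner ℝ (φ (k + 1) i) v ^ 2 := by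
  simp only [infoForm]
  simp_rw [Finset.sum_Icc_succ_top (show 1 ≤ k + 1 by omega), Finset.sum_add_distrib]
  ring

theorem infoForm_nonneg (k : ℕ) (v : EuclideanSpace ℝ (Fin m)) : 0 ≤ infoForm φ k v := by
  unfold infoForm
  have : 0 ≤ ∑ i, ∑ j ∈ Finset.Icc 1 k, inner ℝ (φ j i) v ^ 2 :=
    Finset.sum_nonneg fun _ _ => Finset.sum_nonneg fun _ _ => sq_nonneg _
  positivity

theorem infoForm_le (hm : 0 < m) (k : ℕ) (v : EuclideanSpace ℝ (Fin m)) :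
    infoForm φ k v ≤ totalR φ k * ‖v‖ ^ 2 := by
  have h1 : (n : ℝ) / m ≤ n := div_le_self (by positivity) (by exact_mod_cast hm)
  have h2 : ∑ i, ∑ j ∈ Finset.Icc 1 k, inner ℝ (φ j i) v ^ 2 ≤
      (∑ i, ∑ j ∈ Finset.Icc 1 k, ‖φ j i‖ ^ 2) * ‖v‖ ^ 2 := by
    simp only [Finset.sum_mul]
    refine Finset.sum_le_sum fun i _ => Finset.sum_le_sum fun j _ => ?_
    rw [← mul_pow, ← sq_abs]
    have := abs_real_inner_le_norm (φ j i) v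
    gcongr
  have h3 : totalR φ k = n + ∑ i, ∑ j ∈ Finset.Icc 1 k, ‖φ j i‖ ^ 2 := by
    simp [totalR, r, Finset.sum_add_distrib]
  rw [h3, infoForm, add_mul]
  have := mul_le_mul_of_nonneg_right h1 (sq_nonneg ‖v‖)
  linarith

theorem dotProduct_info_mulVec (k : ℕ) (v : EuclideanSpace ℝ (Fin m)) :
    v.ofLp ⬝ᵥ (info φ k).mulVec v.ofLp = infoForm φ k v := by
  have hv : v.ofLp ⬝ᵥ v.ofLp = ‖v‖ ^ 2 := by
    rw [← real_inner_self_eq_norm_sq, EuclideanSpace.inner_eq_star_dotProduct]; rfl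
  have hφ : ∀ i j, (fun p => φ j i p) ⬝ᵥ v.ofLp = inner ℝ (φ j i) v := by
    intro i j
    rw [EuclideanSpace.inner_eq_star_dotProduct, dotProduct_comm]; rfl
  simp only [info, infoForm, Matrix.add_mulVec, dotProduct_add, Matrix.smul_mulVec,
    Matrix.one_mulVec, dotProduct_smul, hv, Matrix.sum_mulVec, dotProduct_sum,
    Matrix.vecMulVec_mulVec, hφ, smul_eq_mul]
  congr 1
  refine Finset.sum_congr rfl fun i _ => Finset.sum_congr rfl fun j _ => ?_
  rw [op_smul_eq_smul, dotProduct_comm, hφ, smul_eq_mul, sq]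

/-- The summand (n/m) I_m has trace n, matching the n ones in the definition of the r^i. Through the
trace, the largest eigenvalue controls the total energy. -/
theorem trace_info (hm : 0 < m) (k : ℕ) : (info φ k).trace = totalR φ k := by
  have hm' : (m : ℝ) ≠ 0 := by exact_mod_cast hm.ne'
  have e : ∀ i j, (fun p => φ j i p) ⬝ᵥ (fun p => φ j i p) = ‖φ j i‖ ^ 2 := by
    intro i j
    rw [← real_inner_self_eq_norm_sq, EuclideanSpace.inner_eq_star_dotProduct]; rfl
  simp [info, totalR, r, Matrix.trace_sum, Matrix.trace_vecMulVec, e, Finset.sum_add_distrib, hm']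

theorem posDef_info [Nonempty (Fin n)] (hm : 0 < m) (k : ℕ) : (info φ k).PosDef := by
  have hn : (0 : ℝ) < n := by exact_mod_cast Fin.pos_iff_nonempty.2 inferInstance
  have hm' : (0 : ℝ) < m := by exact_mod_cast hm
  refine Matrix.PosDef.add_posSemidef (Matrix.PosDef.one.smul (div_pos hn hm')) ?_
  exact Matrix.posSemidef_sum _ fun i _ => Matrix.posSemidef_sum _ fun j _ =>
    Matrix.posSemidef_vecMulVec_self_star (fun p => φ j i p)

open scoped MatrixOrder in
theorem lamMin_mul_le {A : Matrix (Fin m) (Fin m) ℝ} (hA : A.IsHermitian)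
    (v : EuclideanSpace ℝ (Fin m)) :
    lamMin A * ‖v‖ ^ 2 ≤ v.ofLp ⬝ᵥ A.mulVec v.ofLp := by
  have h1 : (A - algebraMap ℝ _ (lamMin A)).PosSemidef := by
    rw [← Matrix.le_iff]
    refine (algebraMap_le_iff_le_spectrum (ha := hA)).2 fun y hy => ?_
    exact csInf_le A.finite_real_spectrum.bddBelow hy
  have h2 := h1.dotProduct_mulVec_nonneg v.ofLp
  rw [Matrix.sub_mulVec, dotProduct_sub, Algebra.algebraMap_eq_smul_one, Matrix.smul_mulVec,
    Matrix.one_mulVec, dotProduct_smul, star_trivial] at h2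
  have hv : v.ofLp ⬝ᵥ v.ofLp = ‖v‖ ^ 2 := by
    rw [← real_inner_self_eq_norm_sq, EuclideanSpace.inner_eq_star_dotProduct]; rfl
  rw [hv, smul_eq_mul] at h2
  linarith

theorem trace_le_mul_lamMax {A : Matrix (Fin m) (Fin m) ℝ} (hA : A.IsHermitian) :
    A.trace ≤ m * lamMax A := by
  rw [hA.trace_eq_sum_eigenvalues]
  calc ∑ i, ((hA.eigenvalues i : ℝ) : ℝ) ≤ ∑ _i : Fin m, lamMax A :=
        Finset.sum_le_sum fun i _ =>
          le_csSup A.finite_real_spectrum.bddAbove (hA.eigenvalues_mem_spectrum_real i)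
    _ = m * lamMax A := by simp

theorem lamMin_pos (hm : 0 < m) {A : Matrix (Fin m) (Fin m) ℝ} (hA : A.PosDef) :
    0 < lamMin A := by
  have : Nonempty (Fin m) := Fin.pos_iff_nonempty.1 hm
  have hne : (spectrum ℝ A).Nonempty :=
    ⟨_, hA.isHermitian.eigenvalues_mem_spectrum_real (Classical.arbitrary _)⟩
  have hmem : lamMin A ∈ spectrum ℝ A := hne.csInf_mem A.finite_real_spectrum
  rw [hA.isHermitian.spectrum_real_eq_range_eigenvalues] at hmem
  obtain ⟨i, hi⟩ := hmem
  rw [← hi]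
  exact hA.eigenvalues_pos i

/-- A bound on the condition number of the information matrix bounds its form from below. -/
theorem totalR_mul_le_infoForm [Nonempty (Fin n)] (hm : 0 < m) {k : ℕ} {B : ℝ}
    (h : lamMax (info φ k) / lamMin (info φ k) ≤ B) (v : EuclideanSpace ℝ (Fin m)) :
    totalR φ k * ‖v‖ ^ 2 ≤ m * B * infoForm φ k v := by
  have hpd := posDef_info φ hm k
  have hmin := lamMin_pos hm hpd
  rw [div_le_iff₀ hmin] at h
  have h1 := trace_le_mul_lamMax hpd.isHermitian
  rw [trace_info φ hm] at h1
  have h2 := lamMin_mul_le hpd.isHermitian v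
  rw [dotProduct_info_mulVec] at h2
  have h3 : 0 ≤ B * lamMin (info φ k) := by
    have hm' : (0 : ℝ) < m := by exact_mod_cast hm
    have := totalR_pos φ k
    by_contra! hneg
    nlinarith
  have hB : 0 ≤ B := nonneg_of_mul_nonneg_left h3 hmin
  calc totalR φ k * ‖v‖ ^ 2 ≤ m * (B * lamMin (info φ k)) * ‖v‖ ^ 2 := by
        gcongr; exact h1.trans (by gcongr)
    _ = m * B * (lamMin (info φ k) * ‖v‖ ^ 2) := by ring
    _ ≤ m * B * infoForm φ k v := by gcongr

end Info

section Pathwise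

variable (S : SensorNetwork n) (Q : ℕ) (μ ν : ℝ)

/-- The operator driving the estimation error at time `k`. -/
noncomputable def errorGain (k : ℕ) :
    PiLp 2 (fun _ : Fin n => EuclideanSpace ℝ (Fin m)) →ₗ[ℝ]
      PiLp 2 (fun _ : Fin n => EuclideanSpace ℝ (Fin m)) :=
  S.gain ν (φ k) (r φ k) (x S φ k Q)

/-- The normalized noise vector at time `k`, driven by the noise `ξ`. -/
noncomputable def noiseVec (ξ : Fin n → ℝ) (k : ℕ) :
    PiLp 2 (fun _ : Fin n => EuclideanSpace ℝ (Fin m)) :=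
  WithLp.toLp 2 fun i => (ξ i / r φ k i) • φ k i

/-- Symmetry of the weights makes the inner sum -L e, hence z = -X L e; the outer sum applies L once
more. This produces L X L in the gain. -/
theorem error_succ (θ : EuclideanSpace ℝ (Fin m)) (ε y : ℕ → Fin n → ℝ)
    (hy : ∀ k i, y (k + 1) i = inner ℝ θ (φ k i) + ε (k + 1) i)
    (t₀ : Fin n → EuclideanSpace ℝ (Fin m))
    (e : ℕ → PiLp 2 (fun _ : Fin n => EuclideanSpace ℝ (Fin m)))
    (he : ∀ k, e k = WithLp.toLp 2 fun i => θ - estimate S Q μ ν φ y t₀ k i) (k : ℕ) :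
    e (k + 1) = e k - μ • errorGain φ S Q ν k (e k) - μ • noiseVec φ (ε (k + 1)) k := by
  set t := estimate S Q μ ν φ y t₀ k with ht
  have hlap : ∀ i, ∑ l ∈ S.nbr i, S.a l i • (t i - t l) = -S.lap (e k) i := by
    intro i
    rw [S.lap_apply_eq_sum, ← Finset.sum_neg_distrib]
    refine Finset.sum_congr rfl fun l _ => ?_
    rw [S.a_comm, ← smul_neg, he]
    congr 1
    change t i - t l = -((θ - t i) - (θ - t l))
    abel
  have hz : ∀ i, z S Q φ k t i = -(x S φ k Q i • S.lap (e k) i) := by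
    intro i; rw [z, hlap, smul_neg]
  have hzl : ∀ i, ∑ j ∈ S.nbr i, S.a i j • (z S Q φ k t i - z S Q φ k t j) =
      -S.lap (WithLp.toLp 2 fun j => x S φ k Q j • S.lap (e k) j) i := by
    intro i
    rw [S.lap_apply_eq_sum, ← Finset.sum_neg_distrib]
    refine Finset.sum_congr rfl fun l _ => ?_
    rw [← smul_neg, hz, hz]
    congr 1
    abel
  ext1 i
  have h1 : e (k + 1) i = θ - (t i + (μ * (y (k + 1) i - inner ℝ (φ k i) (t i)) / r φ k i) • φ k i
        - (μ * ν) • ∑ j ∈ S.nbr i, S.a i j • (z S Q φ k t i - z S Q φ k t j)) := by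
    rw [he]; rfl
  have h2 : e k i = θ - t i := by rw [he]
  have h3 : y (k + 1) i - inner ℝ (φ k i) (t i) = inner ℝ (φ k i) (e k i) + ε (k + 1) i := by
    rw [hy, h2, inner_sub_right, real_inner_comm θ]; ring
  rw [h1, hzl, h3, PiLp.sub_apply, PiLp.sub_apply, PiLp.smul_apply, PiLp.smul_apply, errorGain,
    S.gain_apply, noiseVec, mul_div_assoc, add_div, mul_smul, add_smul, h2]
  simp only [smul_add, smul_neg, mul_smul]
  abel

end Pathwise

end DistributedSG

/-! ### Convergence along a sample path -/

namespace DistributedSG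

section Pathwise

variable {n m : ℕ} {φ : ℕ → Fin n → EuclideanSpace ℝ (Fin m)}

theorem sum_sq_div_r_le {γ : ℝ} (hγ : ∀ k i, totalR φ k ≤ γ * r φ k i) (k : ℕ) :
    ∑ i, ‖φ (k + 1) i‖ ^ 2 / r φ (k + 1) i ≤
      γ * ((totalR φ (k + 1) - totalR φ k) / totalR φ (k + 1)) := by
  rw [totalR_succ, add_sub_cancel_left, ← totalR_succ, Finset.sum_div, Finset.mul_sum]
  refine Finset.sum_le_sum fun i _ => ?_
  have hr := r_pos φ (k + 1) i
  have ht : 0 < totalR φ (k + 1) := hr.trans_le (r_le_totalR φ (k + 1) i)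
  rw [mul_div_assoc', div_le_div_iff₀ hr ht]
  nlinarith [mul_le_mul_of_nonneg_left (hγ (k + 1) i) (sq_nonneg ‖φ (k + 1) i‖)]

theorem le_sum_sq_div_r (k : ℕ) (f : Fin n → ℝ) (hf : ∀ i, 0 ≤ f i) :
    (∑ i, f i) / totalR φ k ≤ ∑ i, f i / r φ k i := by
  rw [Finset.sum_div]
  exact Finset.sum_le_sum fun i _ =>
    div_le_div_of_nonneg_left (hf i) (r_pos φ k i) (r_le_totalR φ k i)

variable (S : SensorNetwork n) {Q : ℕ} {μ ν : ℝ}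

theorem isSymmNonneg_errorGain (hν : 0 ≤ ν) (k : ℕ) : IsSymmNonneg (errorGain φ S Q ν k) :=
  S.isSymmNonneg_gain hν _ (r_pos φ k)
    (S.diffuse_nonneg (fun i => div_nonneg (sq_nonneg _) (r_pos φ k i).le) Q)

/-- The shift to `k + 1` matters: r_0 = 1 does not contain ‖φ_0‖², so the normalized energy at time
0 can exceed 1, while at later times it cannot. -/
theorem mul_inner_errorGain_le (hμ : 0 ≤ μ) (hν : 0 ≤ ν) (hμν : μ * (1 + 4 * ν) ≤ 1) (k : ℕ)
    (v : PiLp 2 (fun _ : Fin n => EuclideanSpace ℝ (Fin m))) :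
    μ * inner ℝ (errorGain φ S Q ν (k + 1) v) v ≤ ‖v‖ ^ 2 := by
  have h1 : ∀ i, ‖φ (k + 1) i‖ ^ 2 / r φ (k + 1) i ≤ 1 := by
    intro i
    rw [div_le_one (r_pos φ _ i), r_succ]
    linarith [r_pos φ k i]
  have h2 : inner ℝ (errorGain φ S Q ν (k + 1) v) v ≤ 1 * (1 + 4 * ν) * ‖v‖ ^ 2 :=
    S.inner_gain_self_le hν _ (r_pos φ (k + 1)) h1 (S.diffuse_le h1 Q) zero_le_one v
  have h3 := mul_le_mul_of_nonneg_left h2 hμ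
  nlinarith [mul_le_mul_of_nonneg_right hμν (sq_nonneg ‖v‖)]

theorem inner_errorGain_le {γ : ℝ} (hγ : ∀ k i, totalR φ k ≤ γ * r φ k i) (hν : 0 ≤ ν) (k : ℕ)
    (v : PiLp 2 (fun _ : Fin n => EuclideanSpace ℝ (Fin m))) :
    inner ℝ (errorGain φ S Q ν (k + 1) v) v ≤
      γ * (1 + 4 * ν) * ((totalR φ (k + 1) - totalR φ k) / totalR φ (k + 1)) * ‖v‖ ^ 2 := by
  have h0 : ∀ i, 0 ≤ ‖φ (k + 1) i‖ ^ 2 / r φ (k + 1) i := fun i =>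
    div_nonneg (sq_nonneg _) (r_pos φ _ i).le
  have h1 : ∀ i, ‖φ (k + 1) i‖ ^ 2 / r φ (k + 1) i ≤
      γ * ((totalR φ (k + 1) - totalR φ k) / totalR φ (k + 1)) := fun i =>
    (Finset.single_le_sum (f := fun i => ‖φ (k + 1) i‖ ^ 2 / r φ (k + 1) i) (fun i _ => h0 i)
      (Finset.mem_univ i)).trans (sum_sq_div_r_le hγ k)
  refine (S.inner_gain_self_le hν _ (r_pos φ (k + 1)) h1 (S.diffuse_le h1 Q) ?_ v).trans
    (le_of_eq (by ring))
  exact (Finset.sum_nonneg fun i _ => h0 i).trans (sum_sq_div_r_le hγ k)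

/-- Lower bound for the excitation accumulated over a block of times. -/
theorem exists_errorGain_excitation (hm : 0 < m) (hconn : S.graph.Connected)
    (hQ : S.graph.diam ≤ Q) (hν : 0 < ν) (htend : Tendsto (totalR φ) atTop atTop)
    {ρ : ℝ} (hρ1 : 1 ≤ ρ) (hρ : ∀ᶠ k in atTop, totalR φ (k + 1) ≤ ρ * totalR φ k)
    {D : ℝ} (hD1 : 1 ≤ D) (hexc : ∀ᶠ k in atTop, ∀ v : EuclideanSpace ℝ (Fin m),
      totalR φ k * ‖v‖ ^ 2 ≤ D * Real.log (totalR φ k) ^ (1 / 3 : ℝ) * infoForm φ k v) :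
    ∃ c : ℝ, 0 < c ∧ ∀ᶠ s in atTop, ∀ t, s ≤ t →
      ∀ v : PiLp 2 (fun _ : Fin n => EuclideanSpace ℝ (Fin m)),
      c * ((Real.log (totalR φ t) - Real.log (totalR φ s)) /
        (D * ρ * Real.log (totalR φ t) ^ (1 / 3 : ℝ)) - 1) * ‖v‖ ^ 2
        ≤ ∑ k ∈ Finset.Ico s t, inner ℝ (errorGain φ S Q ν (k + 1) v) v := by
  have : Nonempty (Fin n) := hconn.nonempty
  have hn1 : (1 : ℝ) ≤ n := by exact_mod_cast Fin.pos_iff_nonempty.2 inferInstance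
  have hn : (0 : ℝ) < n := by linarith
  obtain ⟨c, hc, hform⟩ := S.exists_pos_mul_le_inner_gain (E := EuclideanSpace ℝ (Fin m)) hconn hQ hν
  refine ⟨c / n, div_pos hc hn, ?_⟩
  filter_upwards [eventually_forall_ge_atTop.2 hρ, eventually_forall_ge_atTop.2 hexc,
    eventually_forall_ge_atTop.2
      ((Real.tendsto_log_atTop.comp htend).eventually_ge_atTop 1)] with s hs1 hs2 hs3 t hst v
  set X : ℕ → ℝ := fun k => Real.log (totalR φ k) with hX
  have hXmono : Monotone X := fun a b hab =>
    Real.log_le_log (totalR_pos φ a) (totalR_monotone φ hab)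
  have hX1 : ∀ k, s ≤ k → 1 ≤ X k := hs3
  set A := D * X t ^ (1 / 3 : ℝ) with hA
  have hA1 : 1 ≤ A := by
    have : 1 ≤ X t ^ (1 / 3 : ℝ) := Real.one_le_rpow (hX1 t hst) (by norm_num)
    nlinarith
  have hA0 : 0 < A := by linarith
  have hρ0 : 0 < ρ := by linarith
  set w := SensorNetwork.avg v with hw
  set Δ := ∑ i, ‖v i - w‖ ^ 2 with hΔ
  set b : ℕ → ℝ := fun k => ∑ i, ‖φ (k + 1) i‖ ^ 2 / r φ (k + 1) i with hb
  have hΔ0 : 0 ≤ Δ := Finset.sum_nonneg fun i _ => sq_nonneg _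
  have e0 : D * ρ * X t ^ (1 / 3 : ℝ) = A * ρ := by rw [hA]; ring
  change c / n * ((X t - X s) / (D * ρ * X t ^ (1 / 3 : ℝ)) - 1) * ‖v‖ ^ 2 ≤ _
  rw [e0]
  set q := (X t - X s) / (A * ρ) - 1 with hq
  -- A nonpositive bracket makes the claim trivial; otherwise the average and the disagreement are
  -- bounded separately, each by `q`.
  rcases le_total q 0 with hq0 | hq0
  · refine le_trans ?_ (Finset.sum_nonneg fun k _ => (isSymmNonneg_errorGain S hν.le _).2 v)
    exact mul_nonpos_of_nonpos_of_nonneg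
      (mul_nonpos_of_nonneg_of_nonpos (div_pos hc hn).le hq0) (sq_nonneg _)
  have h1 : ‖w‖ ^ 2 * q ≤ ∑ k ∈ Finset.Ico s t,
      ∑ i, inner ℝ (φ (k + 1) i) w ^ 2 / r φ (k + 1) i := by
    refine (mul_log_sub_le_sum_sub_div (p := fun k => infoForm φ k w) (totalR_monotone φ)
      (totalR_pos φ) (sq_nonneg ‖w‖) hA0 hρ0 hst (fun k hk hkt => ?_) (infoForm_le φ hm s w)
      (infoForm_nonneg φ t w) hs1).trans (Finset.sum_le_sum fun k _ => ?_)
    · refine (hs2 k hk w).trans (mul_le_mul_of_nonneg_right ?_ (infoForm_nonneg φ k w))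
      have h0 : 0 ≤ X k := zero_le_one.trans (hX1 k hk)
      have h := Real.rpow_le_rpow h0 (hXmono hkt.le) (show (0 : ℝ) ≤ 1 / 3 by norm_num)
      exact mul_le_mul_of_nonneg_left h (by linarith)
    · rw [infoForm_succ, add_sub_cancel_left]
      exact le_sum_sq_div_r _ _ fun i => sq_nonneg _
  have h2 : q ≤ ∑ k ∈ Finset.Ico s t, b k := by
    have h3 : X t - X s ≤ ρ * ∑ k ∈ Finset.Ico s t, b k := by
      rw [← Finset.sum_Ico_sub X hst, Finset.mul_sum]
      refine Finset.sum_le_sum fun k hk => ?_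
      refine (Real.log_sub_log_le_mul_sub_div (totalR_pos φ k) (totalR_monotone φ k.le_succ)
        (hs1 k (Finset.mem_Ico.1 hk).1)).trans (mul_le_mul_of_nonneg_left ?_ hρ0.le)
      rw [totalR_succ, add_sub_cancel_left, ← totalR_succ]
      exact le_sum_sq_div_r _ _ fun i => sq_nonneg _
    have hd : 0 ≤ X t - X s := sub_nonneg.2 (hXmono hst)
    have h4 : (X t - X s) / (A * ρ) ≤ (X t - X s) / ρ :=
      div_le_div_of_nonneg_left hd hρ0 (le_mul_of_one_le_left hρ0.le hA1)
    have h5 : (X t - X s) / ρ ≤ ∑ k ∈ Finset.Ico s t, b k := by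
      rw [div_le_iff₀ hρ0]; linarith
    rw [hq]; linarith
  have h6 : c * (‖w‖ ^ 2 * q + q * Δ) ≤
      ∑ k ∈ Finset.Ico s t, inner ℝ (errorGain φ S Q ν (k + 1) v) v := by
    calc c * (‖w‖ ^ 2 * q + q * Δ)
        ≤ c * (∑ k ∈ Finset.Ico s t, ∑ i, inner ℝ (φ (k + 1) i) w ^ 2 / r φ (k + 1) i +
          (∑ k ∈ Finset.Ico s t, b k) * Δ) := by gcongr
      _ = ∑ k ∈ Finset.Ico s t, c * (∑ i, inner ℝ (φ (k + 1) i) w ^ 2 / r φ (k + 1) i +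
          b k * Δ) := by
        rw [← Finset.mul_sum, Finset.sum_add_distrib, Finset.sum_mul]
      _ ≤ _ := Finset.sum_le_sum fun k _ => hform _ _ (r_pos φ (k + 1)) v
  refine le_trans ?_ h6
  rw [SensorNetwork.sum_norm_sq_eq_avg v, ← hw, ← hΔ]
  have h7 : Δ / n ≤ Δ := div_le_self hΔ0 hn1
  have e1 : c / n * q * (n * ‖w‖ ^ 2 + Δ) = c * (‖w‖ ^ 2 * q + q * (Δ / n)) := by
    field_simp
  rw [e1]
  gcongr

/-- Sample path form of the convergence theorem: the weighted noise series has bounded partial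
sums. -/
theorem tendsto_estimate_of_bounded_noise (hm : 0 < m) (hconn : S.graph.Connected)
    (hQ : S.graph.diam ≤ Q) (hμ : 0 < μ) (hν : 0 < ν) (hμν : μ * (1 + 4 * ν) ≤ 1)
    (θ : EuclideanSpace ℝ (Fin m)) (ε y : ℕ → Fin n → ℝ)
    (hy : ∀ k i, y (k + 1) i = inner ℝ θ (φ k i) + ε (k + 1) i)
    (t₀ : Fin n → EuclideanSpace ℝ (Fin m)) (htend : Tendsto (totalR φ) atTop atTop)
    {γ : ℝ} (hγ : ∀ k i, totalR φ k ≤ γ * r φ k i)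
    {ρ : ℝ} (hρ1 : 1 ≤ ρ) (hρ : ∀ᶠ k in atTop, totalR φ (k + 1) ≤ ρ * totalR φ k)
    {D : ℝ} (hD1 : 1 ≤ D) (hexc : ∀ᶠ k in atTop, ∀ v : EuclideanSpace ℝ (Fin m),
      totalR φ k * ‖v‖ ^ 2 ≤ D * Real.log (totalR φ k) ^ (1 / 3 : ℝ) * infoForm φ k v)
    {δ C : ℝ} (hδ : 0 < δ) (hC : ∀ k, ‖∑ j ∈ Finset.range k,
      totalR φ (j + 1) ^ δ • noiseVec φ (ε (j + 2)) (j + 1)‖ ≤ C) (i : Fin n) :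
    Tendsto (fun k => estimate S Q μ ν φ y t₀ k i) atTop (𝓝 θ) := by
  have : Nonempty (Fin n) := ⟨i⟩
  have hpos := totalR_pos φ
  have hmono := totalR_monotone φ
  have hγ0 : 0 ≤ γ := by
    by_contra! hneg
    nlinarith [hγ 0 i, hpos 0, r_pos φ 0 i]
  set X : ℕ → ℝ := fun k => Real.log (totalR φ k) with hX
  have hXmono : Monotone X := fun a b hab => Real.log_le_log (hpos a) (hmono hab)
  have hXt : Tendsto X atTop atTop := Real.tendsto_log_atTop.comp htend
  set G := fun k => errorGain φ S Q ν (k + 1) with hG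
  have hGs : ∀ k, IsSymmNonneg (G k) := fun k => isSymmNonneg_errorGain S hν.le _
  have hGb : ∀ k v, μ * inner ℝ (G k v) v ≤ ‖v‖ ^ 2 :=
    mul_inner_errorGain_le S hμ.le hν.le hμν
  have hC1 : 0 ≤ γ * (1 + 4 * ν) := by positivity
  have hGg : ∀ k v, inner ℝ (G k v) v ≤ γ * (1 + 4 * ν) * (X (k + 1) - X k) * ‖v‖ ^ 2 := by
    intro k v
    refine (inner_errorGain_le S hγ hν.le k v).trans ?_
    have := Real.sub_div_le_log_sub_log (hpos k) (hpos (k + 1))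
    gcongr
  have hstep : ∀ᶠ k in atTop, X (k + 1) ≤ X k + Real.log ρ := by
    filter_upwards [hρ] with k hk
    have := Real.log_le_log (hpos (k + 1)) hk
    rw [Real.log_mul (by linarith) (hpos k).ne'] at this
    change Real.log _ ≤ Real.log _ + _
    linarith
  obtain ⟨c, hc, hexcG⟩ := exists_errorGain_excitation S hm hconn hQ hν htend hρ1 hρ hD1 hexc
  have hhom : ∀ (v : ℕ → PiLp 2 (fun _ : Fin n => EuclideanSpace ℝ (Fin m))) (k₀ : ℕ),
      (∀ k, k₀ ≤ k → v (k + 1) = v k - μ • G k (v k)) → Tendsto v atTop (𝓝 0) := fun v k₀ hv =>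
    tendsto_zero_of_excitation hGs hμ hGb hXmono hXt hC1 hGg (Real.log_nonneg hρ1) hstep hc
      (by positivity) hexcG hv
  -- These factors undo the weights σ^δ, so `T` below is the tail of the unweighted noise series and
  -- decays like σ^{-δ}.
  set a : ℕ → ℝ := fun k => totalR φ (k + 1) ^ (-δ) with ha
  have ha_anti : Antitone a := fun k l hkl =>
    Real.rpow_le_rpow_of_nonpos (hpos _) (hmono (by omega)) (by linarith)
  have ha0 : Tendsto a atTop (𝓝 0) :=
    (tendsto_rpow_neg_atTop hδ).comp (htend.comp (tendsto_add_atTop_nat 1))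
  obtain ⟨T, hT1, hT2⟩ := exists_tail_of_bounded_partial_sums hC ha_anti ha0
  have hw : ∀ k, a k • (totalR φ (k + 1) ^ δ • noiseVec φ (ε (k + 2)) (k + 1)) =
      noiseVec φ (ε (k + 2)) (k + 1) := by
    intro k
    rw [smul_smul, ha, ← Real.rpow_add (hpos _), neg_add_cancel, Real.rpow_zero, one_smul]
  have hT0 : Tendsto T atTop (𝓝 0) :=
    squeeze_zero_norm hT2 (by simpa using ha0.const_mul (2 * C))
  set e : ℕ → PiLp 2 (fun _ : Fin n => EuclideanSpace ℝ (Fin m)) := fun k =>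
    WithLp.toLp 2 fun i => θ - estimate S Q μ ν φ y t₀ k i with he
  have hrec := error_succ φ S Q μ ν θ ε y hy t₀ e fun k => rfl
  -- Since T_k = w_{k+1} + T_{k+1}, the shifted error u satisfies u_{k+1} = u_k - μ G_k (u_k + μ
  -- T_k), with `G` already shifted by one. The forcing energy is bounded by a multiple of (σ_{k+1}
  -- - σ_k)/σ_{k+1}^{1+2δ}.
  have hu : Tendsto (fun k => e (k + 1) - μ • T k) atTop (𝓝 0) := by
    refine tendsto_zero_of_forced hGs hμ hGb hhom (T := fun k => μ • T k) (fun k => ?_) ?_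
    · rw [hrec (k + 1), sub_add_cancel, hT1 k, hw, smul_add]
      abel
    · have hsum := (summable_sub_div_rpow hmono hpos (η := 2 * δ) (by positivity)).mul_left
        (γ * (1 + 4 * ν) * (μ * (2 * C)) ^ 2)
      refine hsum.of_nonneg_of_le (fun k => (hGs k).2 _) fun k => ?_
      refine (inner_errorGain_le S hγ hν.le k _).trans ?_
      have hp := hpos (k + 1)
      have h1 : ‖μ • T k‖ ^ 2 ≤ (μ * (2 * C)) ^ 2 * (totalR φ (k + 1) ^ (2 * δ))⁻¹ := by
        have h2 : ‖μ • T k‖ ≤ μ * (2 * C) * a k := by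
          rw [norm_smul, Real.norm_of_nonneg hμ.le, mul_assoc]
          exact mul_le_mul_of_nonneg_left (hT2 k) hμ.le
        calc ‖μ • T k‖ ^ 2 ≤ (μ * (2 * C) * a k) ^ 2 := by gcongr
          _ = _ := by
            rw [mul_pow _ (a k), ← Real.rpow_neg hp.le]
            congr 1
            simp only [ha]
            rw [← Real.rpow_natCast, ← Real.rpow_mul hp.le]
            congr 1; push_cast; ring
      have h3 : 0 ≤ γ * (1 + 4 * ν) * ((totalR φ (k + 1) - totalR φ k) / totalR φ (k + 1)) :=
        mul_nonneg hC1 (div_nonneg (sub_nonneg.2 (hmono k.le_succ)) hp.le)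
      refine (mul_le_mul_of_nonneg_left h1 h3).trans (le_of_eq ?_)
      rw [Real.rpow_add hp, Real.rpow_one]
      have := (Real.rpow_pos_of_pos hp (2 * δ)).ne'
      field_simp
  have hlim : Tendsto (fun k => e (k + 1)) atTop (𝓝 0) := by
    simpa using hu.add (hT0.const_smul μ)
  have hlim' : Tendsto e atTop (𝓝 0) := (tendsto_add_atTop_iff_nat 1).1 hlim
  have hcoord : Tendsto (fun k => e k i) atTop (𝓝 0) :=
    ((PiLp.continuous_apply 2 _ i).tendsto 0).comp hlim'
  have := hcoord.const_sub θ
  simpa [he] using this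

end Pathwise

end DistributedSG

/-! ### Measurability and almost sure control of the noise -/

namespace DistributedSG

section Random

variable {Ω : Type*} {n m : ℕ} {φ : ℕ → Fin n → Ω → EuclideanSpace ℝ (Fin m)}
  {ε : ℕ → Fin n → Ω → ℝ}

theorem history_mono : Monotone (history φ ε) := by
  intro k l hkl
  refine sup_le_sup ?_ ?_
  · exact iSup_mono fun i => iSup_mono fun j => iSup_mono' fun h => ⟨h.trans hkl, le_rfl⟩
  · exact iSup_mono fun i => iSup_mono fun j => iSup_mono' fun h => ⟨⟨h.1, h.2.trans hkl⟩, le_rfl⟩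

theorem measurable_regressor_history {j k : ℕ} (h : j ≤ k) (i : Fin n) :
    Measurable[history φ ε k] (φ j i) := by
  refine Measurable.of_comap_le (le_trans ?_ le_sup_left)
  exact le_iSup_of_le i (le_iSup_of_le j (le_iSup_of_le h le_rfl))

theorem measurable_noise_history {j k : ℕ} (h1 : 1 ≤ j) (h : j ≤ k) (i : Fin n) :
    Measurable[history φ ε k] (ε j i) := by
  refine Measurable.of_comap_le (le_trans ?_ le_sup_right)
  exact le_iSup_of_le i (le_iSup_of_le j (le_iSup_of_le ⟨h1, h⟩ le_rfl))

theorem measurable_r_history (k : ℕ) (i : Fin n) :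
    Measurable[history φ ε k] fun ω => r (fun k i => φ k i ω) k i := by
  refine Measurable.const_add ?_ 1
  exact Finset.measurable_fun_sum _ fun j hj =>
    (measurable_norm.comp (measurable_regressor_history (Finset.mem_Icc.1 hj).2 i)).pow_const 2

theorem measurable_totalR_history (k : ℕ) :
    Measurable[history φ ε k] fun ω => totalR (fun k i => φ k i ω) k :=
  Finset.measurable_fun_sum _ fun i _ => measurable_r_history k i

variable [m0 : MeasurableSpace Ω]

theorem history_le (hφ : ∀ k i, Measurable (φ k i)) (hε : ∀ k i, Measurable (ε (k + 1) i))
    (k : ℕ) : history φ ε k ≤ m0 := by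
  refine sup_le (iSup_le fun i => iSup_le fun j => iSup_le fun _ => (hφ j i).comap_le)
    (iSup_le fun i => iSup_le fun j => iSup_le fun h => ?_)
  obtain ⟨j, rfl⟩ : ∃ l, j = l + 1 := ⟨j - 1, by omega⟩
  exact (hε j i).comap_le

/-- The filtration of the histories up to time `k + 1`. -/
def historySucc (hφ : ∀ k i, Measurable (φ k i)) (hε : ∀ k i, Measurable (ε (k + 1) i)) :
    Filtration ℕ m0 where
  seq k := history φ ε (k + 1)
  mono' _ _ hkl := history_mono (Nat.succ_le_succ hkl)
  le' k := history_le hφ hε (k + 1)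

end Random

section Weights

variable {n m : ℕ} {φ : ℕ → Fin n → EuclideanSpace ℝ (Fin m)}

/-- The coefficient of the noise of sensor `i` in coordinate `p` of the weighted noise series. -/
noncomputable def noiseCoeff (φ : ℕ → Fin n → EuclideanSpace ℝ (Fin m)) (δ : ℝ) (i : Fin n)
    (p : Fin m) (k : ℕ) : ℝ :=
  totalR φ k ^ δ * (φ k i p / r φ k i)

theorem sum_noiseVec_apply (δ : ℝ) (ξ : ℕ → Fin n → ℝ) (k : ℕ) (i : Fin n) (p : Fin m) :
    (∑ j ∈ Finset.range k, totalR φ (j + 1) ^ δ • noiseVec φ (ξ j) (j + 1)) i p =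
      ∑ j ∈ Finset.range k, noiseCoeff φ δ i p (j + 1) * ξ j i := by
  simp only [WithLp.ofLp_sum, Finset.sum_apply]
  refine Finset.sum_congr rfl fun j _ => ?_
  simp only [noiseVec, noiseCoeff, PiLp.smul_apply, smul_eq_mul]
  ring

/-- The squared weight gives σ^{2δ}, the normalization (σ_{k+1} - σ_k)/σ_{k+1}² up to γ², and the
noise variance σ^e. The result is summable once 2δ + e < 1. -/
theorem noiseCoeff_sq_mul_le {γ : ℝ} (hγ : ∀ k i, totalR φ k ≤ γ * r φ k i) {δ e c₀ : ℝ}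
    (he : 0 ≤ e) (hc₀ : 0 ≤ c₀) (i : Fin n) (p : Fin m) (k : ℕ) :
    noiseCoeff φ δ i p (k + 1) ^ 2 * (c₀ * normR φ (k + 1) ^ e) ≤
      c₀ * γ ^ 2 * ((totalR φ (k + 1) - totalR φ k) /
        totalR φ (k + 1) ^ (1 + (1 - 2 * δ - e))) := by
  have : Nonempty (Fin n) := ⟨i⟩
  have ht := totalR_pos φ (k + 1)
  have hr := r_pos φ (k + 1) i
  set τ := totalR φ (k + 1) with hτ
  have h1 : normR φ (k + 1) ^ e ≤ τ ^ e :=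
    Real.rpow_le_rpow (zero_le_one.trans (one_le_normR φ _)) (normR_le_totalR φ _) he
  have h2 : φ (k + 1) i p ^ 2 ≤ τ - totalR φ k := by
    rw [hτ, totalR_succ, add_sub_cancel_left]
    calc φ (k + 1) i p ^ 2 ≤ ‖φ (k + 1) i‖ ^ 2 := by
          rw [EuclideanSpace.norm_sq_eq, ← sq_abs]
          exact Finset.single_le_sum (f := fun p => ‖φ (k + 1) i p‖ ^ 2)
            (fun p _ => sq_nonneg _) (Finset.mem_univ p)
      _ ≤ _ := Finset.single_le_sum (f := fun i => ‖φ (k + 1) i‖ ^ 2)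
            (fun i _ => sq_nonneg _) (Finset.mem_univ i)
  have h3 : (φ (k + 1) i p / r φ (k + 1) i) ^ 2 ≤ γ ^ 2 * ((τ - totalR φ k) / τ ^ 2) := by
    rw [div_pow, mul_div_assoc', div_le_div_iff₀ (by positivity) (by positivity)]
    have h4 : τ ^ 2 ≤ (γ * r φ (k + 1) i) ^ 2 := pow_le_pow_left₀ ht.le (hγ (k + 1) i) 2
    calc φ (k + 1) i p ^ 2 * τ ^ 2 ≤ (τ - totalR φ k) * (γ * r φ (k + 1) i) ^ 2 :=
          mul_le_mul h2 h4 (by positivity) ((sq_nonneg _).trans h2)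
      _ = _ := by ring
  have hexp : τ ^ (1 + (1 - 2 * δ - e)) = τ ^ 2 / (τ ^ δ) ^ 2 / τ ^ e := by
    rw [← Real.rpow_natCast (τ ^ δ), ← Real.rpow_mul ht.le, ← Real.rpow_natCast τ 2,
      ← Real.rpow_sub ht, ← Real.rpow_sub ht]
    congr 1; push_cast; ring
  rw [hexp, noiseCoeff, mul_pow]
  have hδp := Real.rpow_pos_of_pos ht δ
  have hep := Real.rpow_pos_of_pos ht e
  calc (τ ^ δ) ^ 2 * (φ (k + 1) i p / r φ (k + 1) i) ^ 2 * (c₀ * normR φ (k + 1) ^ e)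
      ≤ (τ ^ δ) ^ 2 * (γ ^ 2 * ((τ - totalR φ k) / τ ^ 2)) * (c₀ * τ ^ e) := by
        have : 0 ≤ γ ^ 2 * ((τ - totalR φ k) / τ ^ 2) := (sq_nonneg _).trans h3
        have h5 : 0 ≤ normR φ (k + 1) ^ e :=
          Real.rpow_nonneg (zero_le_one.trans (one_le_normR φ _)) _
        gcongr
    _ = _ := by field_simp

theorem exists_norm_sum_noiseVec_le {δ : ℝ} {ξ : ℕ → Fin n → ℝ}
    (h : ∀ i p, ∃ l, Tendsto (fun k => ∑ j ∈ Finset.range k,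
      noiseCoeff φ δ i p (j + 1) * ξ j i) atTop (𝓝 l)) :
    ∃ C, ∀ k, ‖∑ j ∈ Finset.range k, totalR φ (j + 1) ^ δ • noiseVec φ (ξ j) (j + 1)‖ ≤ C := by
  choose l hl using h
  have hlim : Tendsto (fun k => ∑ j ∈ Finset.range k,
      totalR φ (j + 1) ^ δ • noiseVec φ (ξ j) (j + 1)) atTop
      (𝓝 (WithLp.toLp 2 fun i => WithLp.toLp 2 fun p => l i p)) := by
    refine ((PiLp.continuous_toLp 2 _).tendsto _).comp (tendsto_pi_nhds.2 fun i => ?_)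
      |>.congr fun k => WithLp.toLp_ofLp 2 _
    refine ((PiLp.continuous_toLp 2 _).tendsto _).comp (tendsto_pi_nhds.2 fun p => ?_)
      |>.congr fun k => WithLp.toLp_ofLp 2 _
    exact (hl i p).congr fun k => (sum_noiseVec_apply δ ξ k i p).symm
  obtain ⟨C, hC⟩ := (Metric.isBounded_range_of_tendsto _ hlim).exists_norm_le
  exact ⟨C, fun k => hC _ ⟨k, rfl⟩⟩

end Weights

section Noise

variable {Ω : Type*} [MeasurableSpace Ω] {P : Measure Ω} [IsProbabilityMeasure P] {n m : ℕ}
  {φ : ℕ → Fin n → Ω → EuclideanSpace ℝ (Fin m)} {ε : ℕ → Fin n → Ω → ℝ}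

/-- Almost surely, the noise series weighted by some positive power of the total energy has bounded
partial sums. -/
theorem ae_exists_bounded_noise (hφ : ∀ k i, Measurable (φ k i))
    (hε : ∀ k i, Measurable (ε (k + 1) i)) (hnoise : MartingaleDifferenceNoise P φ ε)
    (hcond : BoundedConditionNumber P φ) :
    ∀ᵐ ω ∂P, ∃ δ : ℝ, 0 < δ ∧ ∃ C : ℝ, ∀ k, ‖∑ j ∈ Finset.range k,
      totalR (fun k i => φ k i ω) (j + 1) ^ δ •
        noiseVec (fun k i => φ k i ω) (fun i => ε (j + 2) i ω) (j + 1)‖ ≤ C := by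
  -- The exponent `e` depends on the sample, whereas a martingale transform needs a fixed δ.
  -- Convergence is therefore prepared for all δ = 1/(N+1) on a common event of full measure, and
  -- `N` is chosen afterwards for each sample so that 2δ < 1 - e.
  have hconv : ∀ (N : ℕ) (i : Fin n) (p : Fin m), ∀ᵐ ω ∂P,
      ∑' k, ENNReal.ofReal (noiseCoeff (fun k i => φ k i ω) (1 / (N + 1 : ℝ)) i p (k + 1) ^ 2) *
        (P⁻[fun ω => ENNReal.ofReal (ε (k + 2) i ω ^ 2) | history φ ε (k + 1)]) ω < ⊤ →
      ∃ l, Tendsto (fun k => ∑ j ∈ Finset.range k,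
        noiseCoeff (fun k i => φ k i ω) (1 / (N + 1 : ℝ)) i p (j + 1) * ε (j + 2) i ω)
        atTop (𝓝 l) := by
    intro N i p
    refine ae_tendsto_sum_of_tsum_condLExp_lt_top (historySucc hφ hε)
      (c := fun k ω => noiseCoeff (fun k i => φ k i ω) (1 / (N + 1 : ℝ)) i p (k + 1))
      (ξ := fun k => ε (k + 2) i) (fun k => ?_)
      (fun k => measurable_noise_history (by omega) le_rfl i)
      (fun k => hnoise.integrable (k + 1) i) (fun k => hnoise.condExp_eq_zero (k + 1) i)
    refine Measurable.mul ((measurable_totalR_history (k + 1)).pow_const _)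
      (Measurable.div ?_ (measurable_r_history (k + 1) i))
    exact (EuclideanSpace.proj p).continuous.measurable.comp
      (measurable_regressor_history le_rfl i)
  have hmono : ∀ (k : ℕ) (i : Fin n), ∀ᵐ ω ∂P,
      (P⁻[fun ω => ENNReal.ofReal (ε (k + 2) i ω ^ 2) | history φ ε (k + 1)]) ω ≤
        (P⁻[fun ω => ENNReal.ofReal (∑ i, ε (k + 2) i ω ^ 2) | history φ ε (k + 1)]) ω := by
    intro k i
    refine condLExp_mono (Eventually.of_forall fun ω => ENNReal.ofReal_le_ofReal ?_)
    exact Finset.single_le_sum (f := fun i => ε (k + 2) i ω ^ 2) (fun i _ => sq_nonneg _)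
      (Finset.mem_univ i)
  filter_upwards [ae_all_iff.2 fun N => ae_all_iff.2 fun i => ae_all_iff.2 fun p => hconv N i p,
    ae_all_iff.2 fun k => ae_all_iff.2 fun i => hmono k i, hnoise.second_moment, hcond]
    with ω h1 h2 ⟨c₀, hc₀, e, he0, he1, h3⟩ ⟨γ, _, hγ⟩
  obtain ⟨N, hN⟩ := exists_nat_one_div_lt (show 0 < (1 - e) / 2 by linarith)
  have hδ : 0 < 1 / ((N : ℝ) + 1) := by positivity
  refine ⟨1 / ((N : ℝ) + 1), hδ, exists_norm_sum_noiseVec_le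
    (ξ := fun j i => ε (j + 2) i ω) fun i p => h1 N i p ?_⟩
  have : Nonempty (Fin n) := ⟨i⟩
  have hsum := (summable_sub_div_rpow (totalR_monotone fun k i => φ k i ω)
    (totalR_pos fun k i => φ k i ω)
    (η := 1 - 2 * (1 / ((N : ℝ) + 1)) - e) (by linarith)).mul_left (c₀ * (n * γ) ^ 2)
  refine lt_of_le_of_lt (ENNReal.tsum_le_tsum fun k => ?_) hsum.tsum_ofReal_lt_top
  calc _ ≤ ENNReal.ofReal
        (noiseCoeff (fun k i => φ k i ω) (1 / (N + 1 : ℝ)) i p (k + 1) ^ 2) *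
        ENNReal.ofReal (c₀ * normR (fun k i => φ k i ω) (k + 1) ^ e) := by
        gcongr
        exact (h2 k i).trans (h3 (k + 1))
    _ = _ := (ENNReal.ofReal_mul (sq_nonneg _)).symm
    _ ≤ _ := ENNReal.ofReal_le_ofReal (noiseCoeff_sq_mul_le
        (fun k i => totalR_le_of_condition_number _ (hγ k) i) he0 hc₀.le i p k)

end Noise

/-! ### Transfer of the growth and excitation hypotheses to the total energy -/

section Growth

variable {n m : ℕ} {φ : ℕ → Fin n → EuclideanSpace ℝ (Fin m)}

/-- Growth control at one sensor suffices, because the total lies between r^i and γ r^i. -/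
theorem exists_totalR_succ_le {γ : ℝ} (hγ : ∀ k i, totalR φ k ≤ γ * r φ k i) (i : Fin n)
    (h : limsup (fun k : ℕ => ((r φ (k + 1) i / r φ k i : ℝ) : EReal)) atTop < ⊤) :
    ∃ ρ : ℝ, 1 ≤ ρ ∧ ∀ᶠ k in atTop, totalR φ (k + 1) ≤ ρ * totalR φ k := by
  obtain ⟨b, hb, -⟩ := EReal.lt_iff_exists_real_btwn.1 h
  have hγ0 : 0 ≤ γ := by
    by_contra! hneg
    nlinarith [hγ 0 i, r_le_totalR φ 0 i, r_pos φ 0 i]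
  refine ⟨max 1 (γ * b), le_max_left _ _, ?_⟩
  filter_upwards [eventually_lt_of_limsup_lt hb] with k hk
  have hr := r_pos φ k i
  have h1 : r φ (k + 1) i ≤ b * r φ k i := by
    rw [← div_le_iff₀ hr]; exact_mod_cast hk.le
  have hb0 : 0 ≤ b := by
    by_contra! hneg
    nlinarith [r_pos φ (k + 1) i]
  calc totalR φ (k + 1) ≤ γ * r φ (k + 1) i := hγ _ _
    _ ≤ γ * (b * r φ k i) := by gcongr
    _ ≤ γ * (b * totalR φ k) := by gcongr; exact r_le_totalR φ k i
    _ = γ * b * totalR φ k := by ring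
    _ ≤ max 1 (γ * b) * totalR φ k := by
      gcongr
      · exact hr.le.trans (r_le_totalR φ k i)
      · exact le_max_right _ _

theorem exists_totalR_mul_le_infoForm [Nonempty (Fin n)] (hm : 0 < m) {N : ℝ} (hN : 0 < N) {K₀ : ℕ}
    (h : ∀ k, K₀ ≤ k → lamMax (info φ k) / lamMin (info φ k) ≤
      N * Real.log (normR φ k) ^ (1 / 3 : ℝ)) :
    ∃ D : ℝ, 1 ≤ D ∧ ∀ᶠ k in atTop, ∀ v : EuclideanSpace ℝ (Fin m),
      totalR φ k * ‖v‖ ^ 2 ≤ D * Real.log (totalR φ k) ^ (1 / 3 : ℝ) * infoForm φ k v := by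
  refine ⟨max 1 (m * N), le_max_left _ _, ?_⟩
  filter_upwards [eventually_ge_atTop K₀] with k hk v
  have h1 := one_le_normR φ k
  have h2 := Real.rpow_le_rpow (Real.log_nonneg h1)
    (Real.log_le_log (by linarith) (normR_le_totalR φ k)) (show (0 : ℝ) ≤ 1 / 3 by norm_num)
  have h3 : 0 ≤ Real.log (totalR φ k) ^ (1 / 3 : ℝ) :=
    Real.rpow_nonneg (Real.log_nonneg (one_le_totalR φ k)) _
  refine (totalR_mul_le_infoForm φ hm (h k hk) v).trans
    (mul_le_mul_of_nonneg_right ?_ (infoForm_nonneg φ k v))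
  calc m * (N * Real.log (normR φ k) ^ (1 / 3 : ℝ))
      ≤ m * (N * Real.log (totalR φ k) ^ (1 / 3 : ℝ)) := by gcongr
    _ = m * N * Real.log (totalR φ k) ^ (1 / 3 : ℝ) := by ring
    _ ≤ _ := mul_le_mul_of_nonneg_right (le_max_right _ _) h3

end Growth

end DistributedSG

/-! ### The convergence theorem -/

theorem mainTheorem3 {Ω : Type*} [MeasurableSpace Ω] (P : Measure Ω) [IsProbabilityMeasure P]
    {n m : ℕ} (S : SensorNetwork n) (hconn : S.graph.Connected)
    (Q : ℕ) (hQ : S.graph.diam ≤ Q)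
    (μ ν : ℝ) (hμ : μ ∈ Set.Ioo (0 : ℝ) 1) (hν : ν ∈ Set.Ioo (0 : ℝ) 1)
    (hμν : μ * (1 + 4 * ν) < 1)
    (θ : EuclideanSpace ℝ (Fin m))
    (φ : ℕ → Fin n → Ω → EuclideanSpace ℝ (Fin m)) (hφ : ∀ k i, Measurable (φ k i))
    (ε : ℕ → Fin n → Ω → ℝ) (hε : ∀ k i, Measurable (ε (k + 1) i))
    (y : ℕ → Fin n → Ω → ℝ)
    (hy : ∀ k i ω, y (k + 1) i ω = inner ℝ θ (φ k i ω) + ε (k + 1) i ω)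
    (hgrowth : ∃ i₁ : Fin n, DistributedSG.BoundedGrowth P φ i₁)
    (hcond : DistributedSG.BoundedConditionNumber P φ)
    (hexc : DistributedSG.CooperativeExcitation P φ)
    (hnoise : DistributedSG.MartingaleDifferenceNoise P φ ε)
    (θ₀ : Fin n → Ω → EuclideanSpace ℝ (Fin m)) :
    ∀ᵐ ω ∂P, ∀ i : Fin n,
      Tendsto
        (fun k => DistributedSG.estimate S Q μ ν (fun k i => φ k i ω) (fun k i => y k i ω)
          (fun i => θ₀ i ω) k i)
        atTop (𝓝 θ) := by
  open DistributedSG in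
  have : Nonempty (Fin n) := hconn.nonempty
  obtain ⟨i₁, hgrowth⟩ := hgrowth
  filter_upwards [hgrowth, hcond, hexc, ae_exists_bounded_noise hφ hε hnoise hcond]
    with ω hg ⟨γ, _, hγ⟩ ⟨⟨N, hN, K₀, _, hinfo⟩, htend⟩ ⟨δ, hδ, C, hC⟩ i
  -- In dimension zero all estimates coincide with θ; the information matrix arguments need m > 0.
  rcases Nat.eq_zero_or_pos m with rfl | hm
  · exact tendsto_const_nhds.congr fun k => Subsingleton.elim _ _
  have hγ' := fun k i => totalR_le_of_condition_number (fun k i => φ k i ω) (hγ k) i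
  obtain ⟨ρ, hρ1, hρ⟩ := exists_totalR_succ_le hγ' i₁ hg
  obtain ⟨D, hD1, hD⟩ := exists_totalR_mul_le_infoForm hm hN hinfo
  exact tendsto_estimate_of_bounded_noise S hm hconn hQ hμ.1 hν.1 hμν.le θ
    (fun k i => ε k i ω) (fun k i => y k i ω) (fun k i => hy k i ω) (fun i => θ₀ i ω)
    (tendsto_atTop_mono (normR_le_totalR _) htend) hγ' hρ1 hρ hD1 hD hδ hC i
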